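/- **Setting.** Let $d\in\{2,3\}$ and let $\Omega\subset\mathbb R^d$ be a bounded open set (for instance a bounded Lipschitz domain; no regularity of $\partial\Omega$ is needed). Let $\mathcal V$ be the set of divergence-free fields in $C_0^\infty(\Omega)^d$, $H$ the closure of $\mathcal V$ in $L^2(\Omega)^d$, $V$ the closure of $\mathcal V$ in $H^1(\Omega)^d$, with $\|v\|_H=\|v\|_{L^2(\Omega)}$, $\|v\|_V=\|\nabla v\|_{L^2(\Omega)}$. Let $V'$ be the dual of $V$ with the norm $\|\cdot\|_{V'}$ dual to $\|\cdot\|_V$, and $V\subset H=H'\subset V'$. Let $c_\rho>0$ be a Poincaré constant, i.e. $\|v\|_H\le c_\rho\|v\|_V$ for all $v\in V$ (for instance the best one). The viscosity $\nu:(0,\infty)\to\mathbb R$ depends on time only, is integrable on $(0,S)$ for every $S>0$, and satisfies $$0<\underline\nu=\inf_{t>0}\nu(t),\qquad \overline\nu=\sup_{t>0}\nu(t)<\infty .$$ The force satisfies $f\in L^2(0,S;V')$ for every $S>0$. A weak solution of the Navier–Stokes equations on $(0,\infty)$ with initial value $u_0\in H$ is a function $u$ with $u\in L^2(0,S;V)\cap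 L^\infty(0,S;H)$ for every $S>0$, with a representative that is weakly continuous from $[0,\infty)$ to $H$ and has $u(0)=u_0$, with $\frac{du}{dt}\in L^1_{\mathrm{loc}}((0,\infty);V')$ in the sense of distributions, and such that for almost every $t>0$ $$\Big\langle \frac{du}{dt},v\Big\rangle+\nu(t)\int_\Omega\nabla u:\nabla v\,dx+\int_\Omega (u\cdot\nabla)u\cdot v\,dx=\langle f,v\rangle\qquad\forall v\in V .$$ If $d=3$, a weak solution is moreover understood in the sense of Leray and Hopf: for almost every $s>0$ and all $t\ge s$, $$\tfrac12\|u(t)\|_H^2+\int_s^t\nu(\tau)\|u(\tau)\|_V^2\,d\tau\le\tfrac12\|u(s)\|_H^2+\int_s^t\langle f(\tau),u(\tau)\rangle\,d\tau .$$ If $d=2$, no energy inequality is assumed. **Lemma C.1.** Let $u$ be a weak solution as above. Then for every $T\ge c_\rho^2/\underline\nu$, $$\limsup_{t\to\infty}\frac1T\int_t^{t+T}\nu(\tau)\|u(\tau)\|_V^2\,d\tau\;\le\;\frac{\bar K\,\underline\nu+c_\rho^2}{\underline\nu\,c_\rho^2}\;\limsup_{t\to\infty}\|f(t)\|_{V'}^2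 ,$$ where $$\bar K=\limsup_{t\to\infty}\int_0^t e^{-\phi_s(t)/c_\rho^2}\,ds,\qquad \phi_s(t)=\int_s^t\nu(z)\,dz .$$ Here the limit superior of $\|f(t)\|_{V'}^2$ is the essential one ($f$ is defined for almost every $t$ only), and its value may be $+\infty$. -/

import Mathlib

open MeasureTheory Filter Set Topology
open scoped ENNReal ContDiff

noncomputable section

namespace NSE

/-- The Euclidean space `ℝ^d`. -/
abbrev Vec (d : ℕ) : Type := EuclideanSpace ℝ (Fin d)

/-- `d × d` matrices with the Euclidean (Frobenius) norm; the entry `(i, j)` of a velocity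
gradient is `∂_j u_i`. -/
abbrev Mat (d : ℕ) : Type := EuclideanSpace ℝ (Fin d × Fin d)

/-- The gradient matrix `(∂_j φ_i)_{ij}` of a vector field. -/
def gradMat {d : ℕ} (φ : Vec d → Vec d) (x : Vec d) : Mat d :=
  WithLp.toLp 2 fun p => fderiv ℝ φ x (EuclideanSpace.single p.2 1) p.1

/-- The divergence of a vector field. -/
def divergence {d : ℕ} (φ : Vec d → Vec d) (x : Vec d) : ℝ :=
  ∑ i, gradMat φ x (i, i)

/-- The divergence-free smooth vector fields with compact support in `Ω`. -/
structure IsTestField {d : ℕ} (Ω : Set (Vec d)) (φ : Vec d → Vec d) : Prop where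
  smooth : ContDiff ℝ ∞ φ
  compact : HasCompactSupport φ
  support_subset : tsupport φ ⊆ Ω
  div_free : ∀ x, divergence φ x = 0

/-- Vector fields in `L²(Ω)`. -/
abbrev L2Vec {d : ℕ} (Ω : Set (Vec d)) : Type := Lp (Vec d) 2 (volume.restrict Ω)

/-- Matrix fields in `L²(Ω)`. -/
abbrev L2Mat {d : ℕ} (Ω : Set (Vec d)) : Type := Lp (Mat d) 2 (volume.restrict Ω)

/-- `H`: the closure in `L²(Ω)` of the divergence-free test fields. (The test fields already
form a linear subspace, so the span adds nothing.) -/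
def spaceH {d : ℕ} (Ω : Set (Vec d)) : Submodule ℝ (L2Vec Ω) :=
  (Submodule.span ℝ {g : L2Vec Ω | ∃ φ, IsTestField Ω φ ∧
    g =ᵐ[volume.restrict Ω] φ}).topologicalClosure

/-- `V`: the closure in `H¹(Ω)` of the divergence-free test fields. A field `v` of class `H¹` is
represented by the pair `(v, ∇v)`, so that `H¹(Ω)` is a closed subspace of `L²(Ω) × L²(Ω)`, with
the Hilbert norm `(‖v‖² + ‖∇v‖²)^{1/2}`. -/
def spaceV {d : ℕ} (Ω : Set (Vec d)) : Submodule ℝ (WithLp 2 (L2Vec Ω × L2Mat Ω)) :=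
  (Submodule.span ℝ {g : WithLp 2 (L2Vec Ω × L2Mat Ω) | ∃ φ, IsTestField Ω φ ∧
    g.fst =ᵐ[volume.restrict Ω] φ ∧
    g.snd =ᵐ[volume.restrict Ω] gradMat φ}).topologicalClosure

/-- `H` as a Hilbert space. -/
abbrev HSp {d : ℕ} (Ω : Set (Vec d)) : Type := spaceH Ω

/-- `V` as a Hilbert space, with the `H¹(Ω)` inner product of the pairs `(v, ∇v)`. -/
def VSp {d : ℕ} (Ω : Set (Vec d)) : Type := spaceV Ω

instance {d : ℕ} (Ω : Set (Vec d)) : NormedAddCommGroup (VSp Ω) :=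
  inferInstanceAs (NormedAddCommGroup (spaceV Ω))

instance {d : ℕ} (Ω : Set (Vec d)) : InnerProductSpace ℝ (VSp Ω) :=
  inferInstanceAs (InnerProductSpace ℝ (spaceV Ω))

instance {d : ℕ} (Ω : Set (Vec d)) : CompleteSpace (VSp Ω) :=
  (Submodule.isClosed_topologicalClosure _).completeSpace_coe

/-- The dual `V'` of `V`. -/
abbrev VDual {d : ℕ} (Ω : Set (Vec d)) : Type := StrongDual ℝ (VSp Ω)

/-- The inclusion of `V` in `L²(Ω)`. -/
def toL2 {d : ℕ} (Ω : Set (Vec d)) : VSp Ω →L[ℝ] L2Vec Ω :=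
  (ContinuousLinearMap.fst ℝ (L2Vec Ω) (L2Mat Ω)).comp
    ((WithLp.prodContinuousLinearEquiv 2 ℝ (L2Vec Ω) (L2Mat Ω)).toContinuousLinearMap.comp
      (spaceV Ω).subtypeL)

/-- The (weak) gradient on `V`. -/
def grad {d : ℕ} (Ω : Set (Vec d)) : VSp Ω →L[ℝ] L2Mat Ω :=
  (ContinuousLinearMap.snd ℝ (L2Vec Ω) (L2Mat Ω)).comp
    ((WithLp.prodContinuousLinearEquiv 2 ℝ (L2Vec Ω) (L2Mat Ω)).toContinuousLinearMap.comp
      (spaceV Ω).subtypeL)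

/-- `‖v‖_V`, the `H¹` seminorm `‖∇v‖_{L²(Ω)}`. -/
def normV {d : ℕ} {Ω : Set (Vec d)} (v : VSp Ω) : ℝ := ‖grad Ω v‖

/-- `‖f‖_{V'}`, the norm dual to `‖·‖_V`. -/
def normVDual {d : ℕ} {Ω : Set (Vec d)} (f : VDual Ω) : ℝ≥0∞ :=
  ⨆ v : {v : VSp Ω // normV v ≤ 1}, ‖f v‖ₑ

/-- The embedding `V ⊂ H = H' ⊂ V'`, that is `⟨u, v⟩ = (u, v)_{L²(Ω)}`. -/
def toVDual {d : ℕ} (Ω : Set (Vec d)) (u : VSp Ω) : VDual Ω :=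
  (innerSL ℝ (toL2 Ω u)).comp (toL2 Ω)

/-- The Dirichlet form `a(u, v) = ∫_Ω ∇u : ∇v`. -/
def formA {d : ℕ} {Ω : Set (Vec d)} (u v : VSp Ω) : ℝ := inner ℝ (grad Ω u) (grad Ω v)

/-- The trilinear form `b(u, v, w) = ∫_Ω ((u · ∇) v) · w = ∫_Ω ∑_{i,j} u_j (∂_j v_i) w_i`. -/
def formB {d : ℕ} {Ω : Set (Vec d)} (u v w : VSp Ω) : ℝ :=
  ∫ x in Ω, ∑ i, ∑ j, (toL2 Ω u x) j * (grad Ω v x) (i, j) * (toL2 Ω w x) i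

/-- The best Poincaré constant of `Ω`: the least `C` with `‖v‖_{L²(Ω)} ≤ C ‖∇v‖_{L²(Ω)}` for
all `v ∈ V`. -/
def poincareConst {d : ℕ} (Ω : Set (Vec d)) : ℝ :=
  sInf {C : ℝ | 0 ≤ C ∧ ∀ v : VSp Ω, ‖toL2 Ω v‖ ≤ C * normV v}

/-- `g` is the time derivative of `u` on `(0, ∞)`, in the sense of `V'`-valued distributions. -/
def IsWeakTimeDeriv {d : ℕ} {Ω : Set (Vec d)} (u : ℝ → VSp Ω) (g : ℝ → VDual Ω) : Prop :=
  ∀ η : ℝ → ℝ, ContDiff ℝ ∞ η → HasCompactSupport η → tsupport η ⊆ Ioi 0 →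
    ∫ t in Ioi (0 : ℝ), deriv η t • toVDual Ω (u t) = -∫ t in Ioi (0 : ℝ), η t • g t

/-- `u` is a weak solution on `(0, ∞)` of the Navier-Stokes equations with viscosity `ν(t)`,
force `f` and initial value `u₀`. Here `w` is the weakly continuous `H`-valued representative of
the class `u`, and `u'` the time derivative of `u`. -/
structure IsWeakSolutionWith {d : ℕ} (Ω : Set (Vec d)) (ν : ℝ → ℝ) (f : ℝ → VDual Ω)
    (u₀ : HSp Ω) (u : ℝ → VSp Ω) (w : ℝ → HSp Ω) (u' : ℝ → VDual Ω) : Prop where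
  /-- `u ∈ L²(0, S; V)` for all `S`. -/
  memLp : ∀ S : ℝ, 0 < S → MemLp u 2 (volume.restrict (Ioo 0 S))
  /-- `u = w` almost everywhere. -/
  ae_eq : ∀ᵐ t ∂(volume.restrict (Ioi (0 : ℝ))), toL2 Ω (u t) = (w t : L2Vec Ω)
  /-- `w ∈ L^∞(0, S; H)` for all `S`. -/
  bounded : ∀ S : ℝ, 0 < S → ∃ C : ℝ, ∀ t ∈ Icc 0 S, ‖w t‖ ≤ C
  /-- `w` is weakly continuous on `[0, ∞)`. -/
  weakly_continuous : ∀ h : HSp Ω, ContinuousOn (fun t => inner ℝ (w t) h) (Ici (0 : ℝ))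
  /-- `du/dt ∈ L¹_loc((0, ∞); V')`. -/
  deriv_locallyIntegrable : LocallyIntegrableOn u' (Ioi (0 : ℝ))
  /-- `u' = du/dt`. -/
  isWeakTimeDeriv : IsWeakTimeDeriv u u'
  /-- The weak form of the equations. -/
  equation : ∀ᵐ t ∂(volume.restrict (Ioi (0 : ℝ))), ∀ v : VSp Ω,
    u' t v + ν t * formA (u t) v + formB (u t) (u t) v = f t v
  /-- The initial condition. -/
  initial : w 0 = u₀

/-- The energy inequality of Leray and Hopf for a weak solution, starting at almost every time:
`½‖u(t)‖_H² + ∫_s^t ν ‖u‖_V² ≤ ½‖u(s)‖_H² + ∫_s^t ⟨f, u⟩`. -/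
def EnergyInequality {d : ℕ} {Ω : Set (Vec d)} (ν : ℝ → ℝ) (f : ℝ → VDual Ω)
    (u : ℝ → VSp Ω) (w : ℝ → HSp Ω) : Prop :=
  ∀ᵐ s ∂(volume.restrict (Ioi (0 : ℝ))), ∀ t : ℝ, s ≤ t →
    ‖w t‖ ^ 2 / 2 + ∫ τ in s..t, ν τ * normV (u τ) ^ 2 ≤
      ‖w s‖ ^ 2 / 2 + ∫ τ in s..t, f τ (u τ)

/-- Weak solutions of the Navier-Stokes equations on `(0, ∞)`. In dimension three the energy
inequality is part of the notion (Leray-Hopf solutions); in dimension two nothing is required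
beyond the function spaces and the weak form of the equations. -/
def IsWeakSolution {d : ℕ} (Ω : Set (Vec d)) (ν : ℝ → ℝ) (f : ℝ → VDual Ω)
    (u₀ : HSp Ω) (u : ℝ → VSp Ω) : Prop :=
  ∃ (w : ℝ → HSp Ω) (u' : ℝ → VDual Ω), IsWeakSolutionWith Ω ν f u₀ u w u' ∧
    (d = 3 → EnergyInequality ν f u w)

/-- `K̄ = limsup_{t → ∞} ∫_0^t exp(-φ_s(t) / c²) ds`, where `φ_s(t) = ∫_s^t ν(z) dz`. -/
def Kbar (ν : ℝ → ℝ) (c : ℝ) : ℝ :=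
  limsup (fun t : ℝ => ∫ s in (0 : ℝ)..t, Real.exp (-(∫ z in s..t, ν z) / c ^ 2)) atTop

end NSE

end

/-!
The estimate rests on the energy inequality. Young's inequality absorbs half of the dissipation
into the work of the force, so that once `‖f‖²_{V'} ≤ M` almost everywhere after some time,
`‖u(t)‖² + ∫_s^t ν ‖u‖_V² ≤ ‖u(s)‖² + (M / ν̲) (t - s)` for almost every later `s` and all `t ≥ s`
(`ae_energy_add_dissipation_le`). The Poincaré inequality bounds `‖u‖²` by `c² ‖u‖_V²`, and
Gronwall's lemma gives `limsup ‖u(t)‖² ≤ (M / ν̲) K̄`. The energy inequality on `[t, t + T]` then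
bounds the mean dissipation by `(M / ν̲) (K̄ / T + 1)` in the limit, and `1 / T ≤ ν̲ / c²`
(`eventually_average_le`). The energy inequality is only available from almost every starting time
and the energy may jump downwards, so Gronwall's lemma is proved for integral inequalities of that
kind (`gronwall_of_ae`), by comparison with the solution of the linear equation at the last good
time at which the inequality to be proved holds.

In dimension three the energy inequality is part of the definition of a solution. In dimension two
it follows from the equation (`IsWeakSolutionWith.energyInequality`): Ladyzhenskaya's inequality,
obtained from the Gagliardo–Nirenberg–Sobolev inequality for `‖φ‖²`, makes `formB` a bounded
trilinear form on `V`, antisymmetric in its last two arguments, so that `B(u, u)` and hence `u'`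
belong to `L²(0, S; V')`. For such `u` the increments of the energy satisfy
`‖w(t + h)‖² - ‖w(t)‖² ≤ 2 ∫_t^{t+h} ⟨u'(τ), u(t + h)⟩ dτ`; integrating in `t`, dividing by `h` and letting `h → 0`, the
left-hand side converges at Lebesgue points and the right-hand side by the continuity of
translations in `L²` (`ae_energy_le`). Only the inequality is needed, and weak lower semicontinuity
of the norm extends it to every final time.

The constant `poincareConst Ω` is an infimum, which carries information only if some Poincaré
inequality holds; this is `exists_poincare`, again a consequence of the Sobolev inequality.
-/

namespace NSE

/-! ### Density of test fields and the Poincaré inequality -/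

section

variable {d : ℕ} {Ω : Set (Vec d)}

theorem gradMat_apply (φ : Vec d → Vec d) (x : Vec d) (i j : Fin d) :
    gradMat φ x (i, j) = fderiv ℝ φ x (EuclideanSpace.single j 1) i := rfl

theorem gradMat_add {φ ψ : Vec d → Vec d} {x : Vec d} (hφ : DifferentiableAt ℝ φ x)
    (hψ : DifferentiableAt ℝ ψ x) : gradMat (φ + ψ) x = gradMat φ x + gradMat ψ x := by
  ext ⟨i, j⟩
  simp [gradMat_apply, fderiv_add hφ hψ]

theorem gradMat_const_smul {φ : Vec d → Vec d} {x : Vec d} (hφ : DifferentiableAt ℝ φ x)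
    (a : ℝ) : gradMat (a • φ) x = a • gradMat φ x := by
  ext ⟨i, j⟩
  simp [gradMat_apply, fderiv_const_smul hφ]

theorem IsTestField.differentiable {φ : Vec d → Vec d} (hφ : IsTestField Ω φ) :
    Differentiable ℝ φ :=
  hφ.smooth.differentiable (by simp)

theorem IsTestField.zero : IsTestField Ω (0 : Vec d → Vec d) where
  smooth := contDiff_const
  compact := HasCompactSupport.zero
  support_subset := by simp [tsupport]
  div_free x := by
    simp [divergence, gradMat_apply, show (0 : Vec d → Vec d) = fun _ => 0 from rfl]

theorem IsTestField.add {φ ψ : Vec d → Vec d} (hφ : IsTestField Ω φ) (hψ : IsTestField Ω ψ) :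
    IsTestField Ω (φ + ψ) where
  smooth := hφ.smooth.add hψ.smooth
  compact := hφ.compact.add hψ.compact
  support_subset := (tsupport_add φ ψ).trans (union_subset hφ.support_subset hψ.support_subset)
  div_free x := by
    have h1 := hφ.div_free x
    have h2 := hψ.div_free x
    simp only [divergence] at h1 h2 ⊢
    rw [gradMat_add (hφ.differentiable x) (hψ.differentiable x)]
    simp [Finset.sum_add_distrib, h1, h2]

theorem IsTestField.const_smul {φ : Vec d → Vec d} (hφ : IsTestField Ω φ) (a : ℝ) :
    IsTestField Ω (a • φ) where
  smooth := contDiff_const.smul hφ.smooth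
  compact := hφ.compact.smul_left (f := fun _ => a)
  support_subset := (closure_mono (Function.support_const_smul_subset a φ)).trans
    hφ.support_subset
  div_free x := by
    have h1 := hφ.div_free x
    simp only [divergence] at h1 ⊢
    rw [gradMat_const_smul (hφ.differentiable x)]
    simp [← Finset.mul_sum, h1]

/-- `v ∈ V` is the class of the test field `φ`: its two components are `φ` and the classical
gradient of `φ` almost everywhere in `Ω`. -/
structure IsTestRep (Ω : Set (Vec d)) (v : VSp Ω) (φ : Vec d → Vec d) : Prop where
  test : IsTestField Ω φ
  field_eq : toL2 Ω v =ᵐ[volume.restrict Ω] φ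
  grad_eq : grad Ω v =ᵐ[volume.restrict Ω] gradMat φ

/-- The classes of the test fields are dense in `V`: they already form a linear subspace. -/
theorem dense_isTestRep : Dense {v : VSp Ω | ∃ φ, IsTestRep Ω v φ} := by
  intro v
  set S : Set (WithLp 2 (L2Vec Ω × L2Mat Ω)) := {g | ∃ φ, IsTestField Ω φ ∧
    g.fst =ᵐ[volume.restrict Ω] φ ∧ g.snd =ᵐ[volume.restrict Ω] gradMat φ} with hS
  have hspan : ∀ g ∈ Submodule.span ℝ S, g ∈ S := by
    intro g hg
    induction hg using Submodule.span_induction with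
    | mem x h => exact h
    | zero =>
      refine ⟨0, IsTestField.zero, Lp.coeFn_zero _ _ _, ?_⟩
      refine (Lp.coeFn_zero _ _ _).trans (Eventually.of_forall fun x => ?_)
      ext ⟨i, j⟩
      simp [gradMat_apply, show (0 : Vec d → Vec d) = fun _ => 0 from rfl]
    | add x y _ _ hx hy =>
      obtain ⟨φ, h1, h2, h3⟩ := hx
      obtain ⟨ψ, k1, k2, k3⟩ := hy
      refine ⟨φ + ψ, h1.add k1, (Lp.coeFn_add _ _).trans (h2.add k2),
        (Lp.coeFn_add _ _).trans ((h3.add k3).trans (Eventually.of_forall fun x => ?_))⟩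
      exact (gradMat_add (h1.differentiable x) (k1.differentiable x)).symm
    | smul a x _ hx =>
      obtain ⟨φ, h1, h2, h3⟩ := hx
      refine ⟨a • φ, h1.const_smul a, (Lp.coeFn_smul _ _).trans (h2.const_smul a),
        (Lp.coeFn_smul _ _).trans ((h3.const_smul a).trans (Eventually.of_forall fun x => ?_))⟩
      exact (gradMat_const_smul (h1.differentiable x) a).symm
  have hv : (v : spaceV Ω).1 ∈ closure S := by
    have h : (v : spaceV Ω).1 ∈ closure (Submodule.span ℝ S : Set _) := v.2
    exact closure_mono (fun g hg => hspan g hg) h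
  rw [mem_closure_iff_seq_limit] at hv
  obtain ⟨g, hg, hlim⟩ := hv
  have hmem : ∀ n, g n ∈ spaceV Ω := fun n =>
    Submodule.le_topologicalClosure _ (Submodule.subset_span (hg n))
  rw [mem_closure_iff_seq_limit]
  refine ⟨fun n => (⟨g n, hmem n⟩ : spaceV Ω), fun n => ?_, ?_⟩
  · obtain ⟨φ, h1, h2, h3⟩ := hg n
    exact ⟨φ, h1, h2, h3⟩
  · exact tendsto_subtype_rng.2 hlim

theorem exists_testRep_seq (v : VSp Ω) : ∃ (V : ℕ → VSp Ω) (φ : ℕ → Vec d → Vec d),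
    (∀ n, IsTestRep Ω (V n) (φ n)) ∧ Tendsto V atTop (𝓝 v) := by
  obtain ⟨V, hV, hlim⟩ := mem_closure_iff_seq_limit.1 (dense_isTestRep v)
  choose φ hφ using hV
  exact ⟨V, φ, hφ, hlim⟩

/-- A continuous linear functional on `V` vanishes as soon as it vanishes on test fields. -/
theorem eq_zero_of_testRep (L : VSp Ω →L[ℝ] ℝ) (h : ∀ v φ, IsTestRep Ω v φ → L v = 0) :
    ∀ v, L v = 0 := by
  have h1 : (fun v => L v) = fun _ => (0 : ℝ) :=
    Continuous.ext_on dense_isTestRep L.continuous continuous_const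
      (fun v ⟨φ, hφ⟩ => h v φ hφ)
  exact fun v => congrFun h1 v

theorem toL2_mem_spaceH (v : VSp Ω) : toL2 Ω v ∈ spaceH Ω := by
  obtain ⟨V, φ, h, hlim⟩ := exists_testRep_seq v
  refine mem_closure_of_tendsto (((toL2 Ω).continuous.tendsto v).comp hlim)
    (Eventually.of_forall fun n => Submodule.subset_span ⟨φ n, (h n).test, (h n).field_eq⟩)

theorem norm_sq_eq (v : VSp Ω) : ‖v‖ ^ 2 = ‖toL2 Ω v‖ ^ 2 + ‖grad Ω v‖ ^ 2 :=
  WithLp.prod_norm_sq_eq_of_L2 (v : spaceV Ω).1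

theorem norm_toL2_le (v : VSp Ω) : ‖toL2 Ω v‖ ≤ ‖v‖ := by
  refine le_of_sq_le_sq ?_ (norm_nonneg _)
  rw [norm_sq_eq]; nlinarith [sq_nonneg ‖grad Ω v‖]

theorem norm_grad_le (v : VSp Ω) : ‖grad Ω v‖ ≤ ‖v‖ := by
  refine le_of_sq_le_sq ?_ (norm_nonneg _)
  rw [norm_sq_eq]; nlinarith [sq_nonneg ‖toL2 Ω v‖]

/-- The operator norm of the derivative is at most the Frobenius norm of the gradient matrix. -/
theorem norm_fderiv_le_norm_gradMat (φ : Vec d → Vec d) (x : Vec d) :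
    ‖fderiv ℝ φ x‖ ≤ ‖gradMat φ x‖ := by
  refine ContinuousLinearMap.opNorm_le_bound _ (norm_nonneg _) fun h => ?_
  refine le_of_sq_le_sq ?_ (by positivity)
  have hh : h = ∑ j, h j • EuclideanSpace.single j (1 : ℝ) := by
    ext i; simp [Pi.single_apply]
  have hi : ∀ i, fderiv ℝ φ x h i = ∑ j, gradMat φ x (i, j) * h j := by
    intro i
    conv_lhs => rw [hh]
    simp [gradMat_apply, mul_comm]
  rw [mul_pow, EuclideanSpace.norm_sq_eq, EuclideanSpace.norm_sq_eq, EuclideanSpace.norm_sq_eq,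
    Fintype.sum_prod_type, Finset.sum_mul]
  refine Finset.sum_le_sum fun i _ => ?_
  simp only [Real.norm_eq_abs, sq_abs]
  rw [hi]
  exact Finset.sum_mul_sq_le_sq_mul_sq _ _ _

theorem IsTestField.continuous_fderiv {φ : Vec d → Vec d} (hφ : IsTestField Ω φ) :
    Continuous (fderiv ℝ φ) :=
  hφ.smooth.continuous_fderiv (by simp)

theorem IsTestField.support_fderiv_subset {φ : Vec d → Vec d} (hφ : IsTestField Ω φ) :
    Function.support (fderiv ℝ φ) ⊆ Ω :=
  (_root_.support_fderiv_subset ℝ).trans hφ.support_subset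

theorem eLpNorm_fderiv_restrict {F : Type*} [NormedAddCommGroup F] [NormedSpace ℝ F]
    {ψ : Vec d → F} (h : Function.support (fderiv ℝ ψ) ⊆ Ω) (p : ℝ≥0∞) :
    eLpNorm (fderiv ℝ ψ) p (volume.restrict Ω) = eLpNorm (fderiv ℝ ψ) p volume := by
  rw [← eLpNorm_norm, ← eLpNorm_norm (μ := volume)]
  refine eLpNorm_restrict_eq_of_support_subset fun x hx => h ?_
  simpa using hx

theorem enorm_toL2 (v : VSp Ω) : ‖toL2 Ω v‖ₑ = eLpNorm (toL2 Ω v) 2 (volume.restrict Ω) :=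
  Lp.enorm_def _

theorem enorm_grad (v : VSp Ω) : ‖grad Ω v‖ₑ = eLpNorm (grad Ω v) 2 (volume.restrict Ω) :=
  Lp.enorm_def _

theorem IsTestRep.enorm_toL2_eq {v : VSp Ω} {φ : Vec d → Vec d} (h : IsTestRep Ω v φ) :
    ‖toL2 Ω v‖ₑ = eLpNorm φ 2 (volume.restrict Ω) := by
  rw [enorm_toL2, eLpNorm_congr_ae h.field_eq]

theorem IsTestRep.eLpNorm_fderiv_le {v : VSp Ω} {φ : Vec d → Vec d} (h : IsTestRep Ω v φ) :
    eLpNorm (fderiv ℝ φ) 2 (volume.restrict Ω) ≤ ‖grad Ω v‖ₑ := by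
  rw [enorm_grad, eLpNorm_congr_ae h.grad_eq]
  exact eLpNorm_mono fun x => norm_fderiv_le_norm_gradMat φ x

/-- A Poincaré inequality holds on every bounded set in dimension two or three. -/
theorem exists_poincare (hd : d = 2 ∨ d = 3) (hΩb : Bornology.IsBounded Ω) :
    ∃ C : ℝ, 0 ≤ C ∧ ∀ v : VSp Ω, ‖toL2 Ω v‖ ≤ C * normV v := by
  -- `p = d / 2` lies in `[1, d)` and its Sobolev exponent `d` is at least `2`; since `p ≤ 2`, the
  -- `Lᵖ` norm of the derivative is controlled by its `L²` norm on the bounded set `Ω`.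
  set p : NNReal := d / 2 with hp
  have hfin : Module.finrank ℝ (Vec d) = d := by simp
  have hd2 : (2 : ℝ) ≤ d := by rcases hd with rfl | rfl <;> norm_num
  have hp1 : 1 ≤ p := by
    rw [← NNReal.coe_le_coe, hp]; push_cast; linarith
  have hp2 : (p : ℝ≥0∞) ≤ 2 := by
    have : p ≤ 2 := by
      rw [← NNReal.coe_le_coe, hp]; push_cast
      rcases hd with rfl | rfl <;> norm_num
    exact_mod_cast this
  set C₁ : NNReal := eLpNormLESNormFDerivOfLeConst (Vec d) volume Ω p 2
  set K : ℝ≥0∞ := C₁ * (volume.restrict Ω) univ ^ (1 / (p : ℝ≥0∞).toReal - 1 / (2 : ℝ≥0∞).toReal)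
    with hK
  have hexp : 0 ≤ 1 / (p : ℝ≥0∞).toReal - 1 / (2 : ℝ≥0∞).toReal := by
    have h1 : (p : ℝ) ≤ 2 := by exact_mod_cast hp2
    have h2 : (1 : ℝ) ≤ p := by exact_mod_cast hp1
    simp only [ENNReal.coe_toReal, ENNReal.toReal_ofNat, sub_nonneg]
    exact one_div_le_one_div_of_le (by linarith) h1
  have hKtop : K ≠ ⊤ := by
    refine ENNReal.mul_ne_top ENNReal.coe_ne_top (ENNReal.rpow_ne_top_of_nonneg hexp ?_)
    simpa using hΩb.measure_lt_top.ne
  have htest : ∀ (v : VSp Ω) φ, IsTestRep Ω v φ → ‖toL2 Ω v‖ ≤ K.toReal * normV v := by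
    intro v φ h
    have hsupp : Function.support φ ⊆ Ω := (subset_tsupport φ).trans h.test.support_subset
    have h1 : eLpNorm φ (2 : NNReal) volume ≤ C₁ * eLpNorm (fderiv ℝ φ) p volume := by
      refine eLpNorm_le_eLpNorm_fderiv_of_le volume (h.test.smooth.of_le (by simp)) hsupp hp1 ?_ ?_
        hΩb
      · rw [hfin, ← NNReal.coe_lt_coe, hp]; push_cast; linarith
      · rw [hfin, hp]; push_cast
        rcases hd with rfl | rfl <;> norm_num
    have h2 : ‖toL2 Ω v‖ₑ ≤ K * ‖grad Ω v‖ₑ := calc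
      ‖toL2 Ω v‖ₑ = eLpNorm φ 2 volume := by
        rw [h.enorm_toL2_eq, eLpNorm_restrict_eq_of_support_subset hsupp]
      _ ≤ C₁ * eLpNorm (fderiv ℝ φ) p (volume.restrict Ω) := by
        have hr : eLpNorm (fderiv ℝ φ) p (volume.restrict Ω) = eLpNorm (fderiv ℝ φ) p volume :=
          eLpNorm_fderiv_restrict h.test.support_fderiv_subset p
        rw [hr]
        exact_mod_cast h1
      _ ≤ C₁ * (eLpNorm (fderiv ℝ φ) 2 (volume.restrict Ω) * (volume.restrict Ω) univ ^
          (1 / (p : ℝ≥0∞).toReal - 1 / (2 : ℝ≥0∞).toReal)) := by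
        gcongr
        exact eLpNorm_le_eLpNorm_mul_rpow_measure_univ hp2
          h.test.continuous_fderiv.aestronglyMeasurable
      _ = K * eLpNorm (fderiv ℝ φ) 2 (volume.restrict Ω) := by rw [hK]; ring
      _ ≤ K * ‖grad Ω v‖ₑ := by gcongr; exact h.eLpNorm_fderiv_le
    have h3 := ENNReal.toReal_mono (ENNReal.mul_ne_top hKtop enorm_ne_top) h2
    rwa [ENNReal.toReal_mul, toReal_enorm, toReal_enorm] at h3
  refine ⟨K.toReal, ENNReal.toReal_nonneg, fun v => ?_⟩
  obtain ⟨V, φ, h, hlim⟩ := exists_testRep_seq v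
  have hc1 : Continuous fun v : VSp Ω => ‖toL2 Ω v‖ := (toL2 Ω).continuous.norm
  have hc2 : Continuous fun v : VSp Ω => K.toReal * normV v :=
    continuous_const.mul (grad Ω).continuous.norm
  exact le_of_tendsto_of_tendsto' ((hc1.tendsto v).comp hlim) ((hc2.tendsto v).comp hlim)
    fun n => htest (V n) (φ n) (h n)

/-- The infimum in `poincareConst` is attained, so every `c ≥ poincareConst Ω` is a Poincaré
constant. -/
theorem norm_toL2_le_of_poincareConst_le (hd : d = 2 ∨ d = 3) (hΩb : Bornology.IsBounded Ω)
    {c : ℝ} (hc : poincareConst Ω ≤ c) (v : VSp Ω) : ‖toL2 Ω v‖ ≤ c * normV v := by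
  -- the infimum of an empty set would be the junk value `0`
  have hne : {C : ℝ | 0 ≤ C ∧ ∀ v : VSp Ω, ‖toL2 Ω v‖ ≤ C * normV v}.Nonempty :=
    exists_poincare hd hΩb
  have hn : 0 ≤ normV v := norm_nonneg _
  have h1 : ‖toL2 Ω v‖ ≤ poincareConst Ω * normV v := by
    rcases hn.eq_or_lt with h0 | h0
    · obtain ⟨C, -, hC⟩ := hne
      have := hC v
      rw [← h0] at this ⊢
      simpa using this
    · rw [← div_le_iff₀ h0]
      exact le_csInf hne fun C hC => (div_le_iff₀ h0).2 (hC.2 v)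
  exact h1.trans (by gcongr)

end

/-! ### Ladyzhenskaya's inequality -/

section

variable {d : ℕ} {Ω : Set (Vec d)}

theorem eLpNorm_norm_sq {α E : Type*} [MeasurableSpace α] [NormedAddCommGroup E] (μ : Measure α)
    (f : α → E) : eLpNorm (fun x => ‖f x‖ ^ 2) 2 μ = eLpNorm f 4 μ ^ 2 := by
  have h := eLpNorm_norm_rpow (μ := μ) (p := 2) f (q := 2) (by norm_num)
  have h4 : (2 : ℝ≥0∞) * ENNReal.ofReal 2 = 4 := by
    rw [show ENNReal.ofReal 2 = 2 by simp]; norm_num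
  rw [h4] at h
  simpa using h

instance holderTriple_four_four_two : ENNReal.HolderTriple 4 4 2 where
  inv_add_inv_eq_inv := by
    rw [show (4 : ℝ≥0∞) = 2 * 2 by norm_num, ENNReal.mul_inv (by simp) (by simp), ← mul_add,
      ENNReal.inv_two_add_inv_two, mul_one]

/-- **Ladyzhenskaya's inequality** in the plane. For test fields it is the
Gagliardo–Nirenberg–Sobolev inequality with exponents `1` and `2` for the function `‖φ‖²`; Fatou's
lemma along an almost everywhere convergent subsequence extends it to `V`. -/
theorem exists_ladyzhenskaya (Ω : Set (Vec 2)) : ∃ C : NNReal, ∀ v : VSp Ω,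
    eLpNorm (toL2 Ω v) 4 (volume.restrict Ω) ^ 2 ≤ C * ‖toL2 Ω v‖ₑ * ‖grad Ω v‖ₑ := by
  set C₁ : NNReal := eLpNormLESNormFDerivOneConst (volume : Measure (Vec 2)) ((2 : NNReal) : ℝ)
  have htest : ∀ (v : VSp Ω) φ, IsTestRep Ω v φ →
      eLpNorm (toL2 Ω v) 4 (volume.restrict Ω) ^ 2 ≤
        (C₁ * 2 : NNReal) * ‖toL2 Ω v‖ₑ * ‖grad Ω v‖ₑ := by
    intro v φ h
    have hsm : ContDiff ℝ 1 φ := h.test.smooth.of_le (by simp)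
    have hsupp : Function.support φ ⊆ Ω := (subset_tsupport φ).trans h.test.support_subset
    have hsm2 : ContDiff ℝ 1 fun x => ‖φ x‖ ^ 2 := hsm.norm_sq ℝ
    have hcs : HasCompactSupport fun x => ‖φ x‖ ^ 2 :=
      h.test.compact.comp_left (g := fun y : Vec 2 => ‖y‖ ^ 2) (by simp)
    have hconj : NNReal.HolderConjugate (Module.finrank ℝ (Vec 2)) 2 := by
      have : (Module.finrank ℝ (Vec 2) : NNReal) = 2 := by simp
      rw [this, NNReal.holderConjugate_iff]
      norm_num
    have h1 := eLpNorm_le_eLpNorm_fderiv_one volume hsm2 hcs hconj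
    have hder : ∀ x, ‖fderiv ℝ (fun x => ‖φ x‖ ^ 2) x‖ ≤ (2 : NNReal) * ‖φ x‖ * ‖fderiv ℝ φ x‖ := by
      intro x
      have hd := (h.test.differentiable x).hasFDerivAt.norm_sq
      rw [hd.fderiv]
      calc _ ≤ ‖(2 : ℝ)‖ * (‖innerSL ℝ (φ x)‖ * ‖fderiv ℝ φ x‖) := by
            rw [two_smul, ← two_smul ℝ, norm_smul]
            gcongr
            exact ContinuousLinearMap.opNorm_comp_le _ _
        _ = _ := by rw [innerSL_apply_norm]; simp [mul_assoc]
    have hsupp2 : Function.support (fderiv ℝ fun x => ‖φ x‖ ^ 2) ⊆ Ω := by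
      refine (support_fderiv_subset ℝ).trans (Subset.trans ?_ h.test.support_subset)
      refine closure_mono fun x hx => ?_
      simpa using hx
    calc eLpNorm (toL2 Ω v) 4 (volume.restrict Ω) ^ 2
        = eLpNorm φ 4 (volume.restrict Ω) ^ 2 := by rw [eLpNorm_congr_ae h.field_eq]
      _ ≤ eLpNorm (fun x => ‖φ x‖ ^ 2) 2 volume := by
        rw [← eLpNorm_norm_sq]
        exact eLpNorm_mono_measure _ Measure.restrict_le_self
      _ ≤ C₁ * eLpNorm (fderiv ℝ fun x => ‖φ x‖ ^ 2) 1 (volume.restrict Ω) := by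
        have hr : eLpNorm (fderiv ℝ fun x => ‖φ x‖ ^ 2) 1 (volume.restrict Ω) =
            eLpNorm (fderiv ℝ fun x => ‖φ x‖ ^ 2) 1 volume :=
          eLpNorm_fderiv_restrict hsupp2 1
        rw [hr]
        exact_mod_cast h1
      _ ≤ C₁ * eLpNorm (fun x => (2 * ‖φ x‖ * ‖fderiv ℝ φ x‖)) 1 (volume.restrict Ω) := by
        gcongr
        exact eLpNorm_mono_real fun x => by simpa using hder x
      _ ≤ C₁ * ((2 : NNReal) * eLpNorm φ 2 (volume.restrict Ω) *
          eLpNorm (fderiv ℝ φ) 2 (volume.restrict Ω)) := by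
        gcongr
        refine eLpNorm_le_eLpNorm_mul_eLpNorm'_of_norm (μ := volume.restrict Ω)
          hsm.continuous.aestronglyMeasurable
          h.test.continuous_fderiv.aestronglyMeasurable (fun a b => 2 * ‖a‖ * ‖b‖) 2
          (Eventually.of_forall fun x => ?_)
        simp
      _ ≤ C₁ * ((2 : NNReal) * ‖toL2 Ω v‖ₑ * ‖grad Ω v‖ₑ) := by
        rw [h.enorm_toL2_eq]
        gcongr
        exact h.eLpNorm_fderiv_le
      _ = _ := by push_cast; ring
  refine ⟨C₁ * 2, fun v => ?_⟩
  obtain ⟨V, φ, h, hlim⟩ := exists_testRep_seq v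
  have hl2 : Tendsto (fun n => toL2 Ω (V n)) atTop (𝓝 (toL2 Ω v)) :=
    ((toL2 Ω).continuous.tendsto v).comp hlim
  have hlg : Tendsto (fun n => grad Ω (V n)) atTop (𝓝 (grad Ω v)) :=
    ((grad Ω).continuous.tendsto v).comp hlim
  obtain ⟨ns, hns, hae⟩ := (tendstoInMeasure_of_tendsto_Lp hl2).exists_seq_tendsto_ae
  have hae2 : ∀ᵐ x ∂(volume.restrict Ω),
      Tendsto (fun n => ‖toL2 Ω (V (ns n)) x‖ ^ 2) atTop (𝓝 (‖toL2 Ω v x‖ ^ 2)) := by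
    filter_upwards [hae] with x hx using hx.norm.pow 2
  have hfatou := Lp.eLpNorm_lim_le_liminf_eLpNorm (p := 2) (μ := volume.restrict Ω)
    (f := fun n x => ‖toL2 Ω (V (ns n)) x‖ ^ 2)
    (fun n => (Lp.aestronglyMeasurable _).norm.pow 2) _ hae2
  simp only [eLpNorm_norm_sq] at hfatou
  have hR : Tendsto (fun n => ((C₁ * 2 : NNReal) : ℝ≥0∞) * ‖toL2 Ω (V (ns n))‖ₑ *
      ‖grad Ω (V (ns n))‖ₑ) atTop
      (𝓝 (((C₁ * 2 : NNReal) : ℝ≥0∞) * ‖toL2 Ω v‖ₑ * ‖grad Ω v‖ₑ)) := by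
    refine ENNReal.Tendsto.mul (ENNReal.Tendsto.const_mul
      ((continuous_enorm.tendsto _).comp (hl2.comp hns.tendsto_atTop)) (Or.inr ENNReal.coe_ne_top))
      (Or.inr enorm_ne_top) ((continuous_enorm.tendsto _).comp (hlg.comp hns.tendsto_atTop))
      (Or.inr (ENNReal.mul_ne_top ENNReal.coe_ne_top enorm_ne_top))
  refine hfatou.trans ?_
  rw [← hR.liminf_eq]
  exact liminf_le_liminf (Eventually.of_forall fun n => htest _ _ (h (ns n)))

end

/-! ### The trilinear form in the plane -/

section

variable {d : ℕ} {Ω : Set (Vec d)}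

/-- The pointwise trilinear expression `∑ a_j M_ij b_i` under the integral of `formB`. -/
def convTerm (a : Vec d) (M : Mat d) (b : Vec d) : ℝ := ∑ i, ∑ j, a j * M (i, j) * b i

theorem formB_eq (u v w : VSp Ω) :
    formB u v w = ∫ x in Ω, convTerm (toL2 Ω u x) (grad Ω v x) (toL2 Ω w x) := rfl

theorem abs_convTerm_le (a : Vec d) (M : Mat d) (b : Vec d) :
    |convTerm a M b| ≤ ‖a‖ * ‖M‖ * ‖b‖ := by
  set N : Mat d := WithLp.toLp 2 fun p => b p.1 * a p.2 with hN
  have h1 : convTerm a M b = inner ℝ M N := by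
    rw [PiLp.inner_apply, Fintype.sum_prod_type]
    refine Finset.sum_congr rfl fun i _ => Finset.sum_congr rfl fun j _ => ?_
    simp [hN]; ring
  have h2 : ‖N‖ = ‖b‖ * ‖a‖ := by
    rw [← sq_eq_sq₀ (norm_nonneg _) (by positivity), mul_pow, EuclideanSpace.norm_sq_eq,
      EuclideanSpace.norm_sq_eq, EuclideanSpace.norm_sq_eq, Fintype.sum_prod_type,
      Finset.sum_mul_sum]
    simp [hN, mul_pow]
  rw [h1]
  calc _ ≤ ‖M‖ * ‖N‖ := abs_real_inner_le_norm _ _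
    _ = _ := by rw [h2]; ring

theorem convTerm_add_left (a a' : Vec d) (M : Mat d) (b : Vec d) :
    convTerm (a + a') M b = convTerm a M b + convTerm a' M b := by
  simp [convTerm, add_mul, Finset.sum_add_distrib]

theorem convTerm_add_mid (a : Vec d) (M M' : Mat d) (b : Vec d) :
    convTerm a (M + M') b = convTerm a M b + convTerm a M' b := by
  simp [convTerm, mul_add, add_mul, Finset.sum_add_distrib]

theorem convTerm_add_right (a : Vec d) (M : Mat d) (b b' : Vec d) :
    convTerm a M (b + b') = convTerm a M b + convTerm a M b' := by
  simp [convTerm, mul_add, Finset.sum_add_distrib]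

theorem convTerm_smul_left (r : ℝ) (a : Vec d) (M : Mat d) (b : Vec d) :
    convTerm (r • a) M b = r * convTerm a M b := by
  simp [convTerm, Finset.mul_sum, mul_assoc]

theorem convTerm_smul_mid (r : ℝ) (a : Vec d) (M : Mat d) (b : Vec d) :
    convTerm a (r • M) b = r * convTerm a M b := by
  simp [convTerm, Finset.mul_sum, mul_assoc, mul_left_comm]

theorem convTerm_smul_right (r : ℝ) (a : Vec d) (M : Mat d) (b : Vec d) :
    convTerm a M (r • b) = r * convTerm a M b := by
  simp [convTerm, Finset.mul_sum, mul_assoc, mul_left_comm]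

theorem aestronglyMeasurable_convTerm_comp {α : Type*} [MeasurableSpace α] {μ : Measure α}
    {f h : α → Vec d} {g : α → Mat d} (hf : AEStronglyMeasurable f μ)
    (hg : AEStronglyMeasurable g μ) (hh : AEStronglyMeasurable h μ) :
    AEStronglyMeasurable (fun x => convTerm (f x) (g x) (h x)) μ := by
  unfold convTerm
  have h1 : ∀ i, AEStronglyMeasurable (fun x => f x i) μ := fun i =>
    (EuclideanSpace.proj (𝕜 := ℝ) i : Vec d →L[ℝ] ℝ).continuous.comp_aestronglyMeasurable hf
  have h2 : ∀ i, AEStronglyMeasurable (fun x => h x i) μ := fun i =>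
    (EuclideanSpace.proj (𝕜 := ℝ) i : Vec d →L[ℝ] ℝ).continuous.comp_aestronglyMeasurable hh
  have h3 : ∀ i, AEStronglyMeasurable (fun x => g x i) μ := fun i =>
    (EuclideanSpace.proj (𝕜 := ℝ) i : Mat d →L[ℝ] ℝ).continuous.comp_aestronglyMeasurable hg
  fun_prop

theorem aestronglyMeasurable_convTerm (u v w : VSp Ω) :
    AEStronglyMeasurable (fun x => convTerm (toL2 Ω u x) (grad Ω v x) (toL2 Ω w x))
      (volume.restrict Ω) :=
  aestronglyMeasurable_convTerm_comp (Lp.aestronglyMeasurable _) (Lp.aestronglyMeasurable _)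
    (Lp.aestronglyMeasurable _)

/-- Hölder's inequality with exponents `4`, `2` and `4`. -/
theorem lintegral_convTerm_le (u v w : VSp Ω) :
    ∫⁻ x in Ω, ‖convTerm (toL2 Ω u x) (grad Ω v x) (toL2 Ω w x)‖ₑ ≤
      eLpNorm (toL2 Ω u) 4 (volume.restrict Ω) * eLpNorm (toL2 Ω w) 4 (volume.restrict Ω) *
        ‖grad Ω v‖ₑ := by
  set μ := volume.restrict Ω
  have h1 : eLpNorm (fun x => ‖toL2 Ω u x‖ * ‖toL2 Ω w x‖) 2 μ ≤
      (1 : NNReal) * eLpNorm (toL2 Ω u) 4 μ * eLpNorm (toL2 Ω w) 4 μ :=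
    eLpNorm_le_eLpNorm_mul_eLpNorm'_of_norm (Lp.aestronglyMeasurable _)
      (Lp.aestronglyMeasurable _) (fun a b => ‖a‖ * ‖b‖) 1 (Eventually.of_forall fun x => by simp)
  have h2 : eLpNorm (fun x => (‖toL2 Ω u x‖ * ‖toL2 Ω w x‖) * ‖grad Ω v x‖) 1 μ ≤
      (1 : NNReal) * eLpNorm (fun x => ‖toL2 Ω u x‖ * ‖toL2 Ω w x‖) 2 μ *
        eLpNorm (grad Ω v) 2 μ :=
    eLpNorm_le_eLpNorm_mul_eLpNorm'_of_norm
      ((Lp.aestronglyMeasurable _).norm.mul (Lp.aestronglyMeasurable _).norm)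
      (Lp.aestronglyMeasurable _) (fun a b => a * ‖b‖) 1 (Eventually.of_forall fun x => by simp)
  rw [← eLpNorm_one_eq_lintegral_enorm, enorm_grad]
  calc _ ≤ eLpNorm (fun x => (‖toL2 Ω u x‖ * ‖toL2 Ω w x‖) * ‖grad Ω v x‖) 1 μ :=
        eLpNorm_mono_real fun x => (abs_convTerm_le _ _ _).trans (by rw [mul_right_comm])
    _ ≤ _ := h2
    _ ≤ _ := by
        simp only [ENNReal.coe_one, one_mul] at h1 ⊢
        gcongr

theorem enorm_formB_le (u v w : VSp Ω) :
    ‖formB u v w‖ₑ ≤ eLpNorm (toL2 Ω u) 4 (volume.restrict Ω) *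
      eLpNorm (toL2 Ω w) 4 (volume.restrict Ω) * ‖grad Ω v‖ₑ :=
  (enorm_integral_le_lintegral_enorm _).trans (lintegral_convTerm_le u v w)

theorem exists_eLpNorm_four_le (Ω : Set (Vec 2)) : ∃ C : NNReal, ∀ v : VSp Ω,
    eLpNorm (toL2 Ω v) 4 (volume.restrict Ω) ≤ C * ‖v‖ₑ := by
  obtain ⟨C, hC⟩ := exists_ladyzhenskaya Ω
  refine ⟨C + 1, fun v => ?_⟩
  have h1 : ‖toL2 Ω v‖ₑ ≤ ‖v‖ₑ := enorm_le_iff_norm_le.2 (norm_toL2_le v)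
  have h2 : ‖grad Ω v‖ₑ ≤ ‖v‖ₑ := enorm_le_iff_norm_le.2 (norm_grad_le v)
  rw [← ENNReal.pow_le_pow_left_iff two_ne_zero]
  refine (hC v).trans ?_
  calc (C : ℝ≥0∞) * ‖toL2 Ω v‖ₑ * ‖grad Ω v‖ₑ ≤ C * ‖v‖ₑ * ‖v‖ₑ := by gcongr
    _ = C * ‖v‖ₑ ^ 2 := by ring
    _ ≤ ((C + 1 : NNReal) : ℝ≥0∞) ^ 2 * ‖v‖ₑ ^ 2 := by
        gcongr
        norm_cast
        nlinarith [sq_nonneg C, C.2]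
    _ = _ := by rw [mul_pow]

section Plane

variable {Ω : Set (Vec 2)}

theorem exists_norm_formB_le (Ω : Set (Vec 2)) : ∃ C : ℝ, ∀ u v w : VSp Ω,
    ‖formB u v w‖ ≤ C * ‖u‖ * ‖v‖ * ‖w‖ := by
  obtain ⟨C, hC⟩ := exists_eLpNorm_four_le Ω
  refine ⟨C * C, fun u v w => ?_⟩
  have h2 : ‖grad Ω v‖ₑ ≤ ‖v‖ₑ := enorm_le_iff_norm_le.2 (norm_grad_le v)
  have h : ‖formB u v w‖ₑ ≤ (C * ‖u‖ₑ) * (C * ‖w‖ₑ) * ‖v‖ₑ := by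
    refine (enorm_formB_le u v w).trans ?_
    gcongr
    exacts [hC u, hC w]
  have h3 := ENNReal.toReal_mono (by finiteness) h
  simp only [ENNReal.toReal_mul, toReal_enorm, ENNReal.coe_toReal] at h3
  linarith

theorem integrable_convTerm (u v w : VSp Ω) :
    Integrable (fun x => convTerm (toL2 Ω u x) (grad Ω v x) (toL2 Ω w x))
      (volume.restrict Ω) := by
  refine ⟨aestronglyMeasurable_convTerm u v w, (lintegral_convTerm_le u v w).trans_lt ?_⟩
  obtain ⟨C, hC⟩ := exists_eLpNorm_four_le Ω
  have h : ∀ u : VSp Ω, eLpNorm (toL2 Ω u) 4 (volume.restrict Ω) < ⊤ := fun u =>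
    (hC u).trans_lt (ENNReal.mul_lt_top ENNReal.coe_lt_top enorm_lt_top)
  exact ENNReal.mul_lt_top (ENNReal.mul_lt_top (h u) (h w)) enorm_lt_top

theorem isBoundedLinearMap_formB_left (v w : VSp Ω) :
    IsBoundedLinearMap ℝ fun u => formB u v w := by
  obtain ⟨C, hC⟩ := exists_norm_formB_le Ω
  refine IsLinearMap.with_bound ⟨fun u u' => ?_, fun r u => ?_⟩ (C * ‖v‖ * ‖w‖)
    fun u => (hC u v w).trans_eq (by ring)
  · simp only [formB_eq]
    rw [← integral_add (integrable_convTerm u v w) (integrable_convTerm u' v w)]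
    refine integral_congr_ae ?_
    rw [map_add]
    filter_upwards [Lp.coeFn_add (toL2 Ω u) (toL2 Ω u')] with x hx
    rw [hx, Pi.add_apply, convTerm_add_left]
  · simp only [formB_eq, smul_eq_mul]
    rw [← integral_const_mul]
    refine integral_congr_ae ?_
    rw [map_smul]
    filter_upwards [Lp.coeFn_smul r (toL2 Ω u)] with x hx
    rw [hx, Pi.smul_apply, convTerm_smul_left]

theorem isBoundedLinearMap_formB_mid (u w : VSp Ω) :
    IsBoundedLinearMap ℝ fun v => formB u v w := by
  obtain ⟨C, hC⟩ := exists_norm_formB_le Ω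
  refine IsLinearMap.with_bound ⟨fun v v' => ?_, fun r v => ?_⟩ (C * ‖u‖ * ‖w‖)
    fun v => (hC u v w).trans_eq (by ring)
  · simp only [formB_eq]
    rw [← integral_add (integrable_convTerm u v w) (integrable_convTerm u v' w)]
    refine integral_congr_ae ?_
    rw [map_add]
    filter_upwards [Lp.coeFn_add (grad Ω v) (grad Ω v')] with x hx
    rw [hx, Pi.add_apply, convTerm_add_mid]
  · simp only [formB_eq, smul_eq_mul]
    rw [← integral_const_mul]
    refine integral_congr_ae ?_
    rw [map_smul]
    filter_upwards [Lp.coeFn_smul r (grad Ω v)] with x hx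
    rw [hx, Pi.smul_apply, convTerm_smul_mid]

theorem isBoundedLinearMap_formB_right (u v : VSp Ω) :
    IsBoundedLinearMap ℝ fun w => formB u v w := by
  obtain ⟨C, hC⟩ := exists_norm_formB_le Ω
  refine IsLinearMap.with_bound ⟨fun w w' => ?_, fun r w => ?_⟩ (C * ‖u‖ * ‖v‖)
    fun w => (hC u v w)
  · simp only [formB_eq]
    rw [← integral_add (integrable_convTerm u v w) (integrable_convTerm u v w')]
    refine integral_congr_ae ?_
    rw [map_add]
    filter_upwards [Lp.coeFn_add (toL2 Ω w) (toL2 Ω w')] with x hx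
    rw [hx, Pi.add_apply, convTerm_add_right]
  · simp only [formB_eq, smul_eq_mul]
    rw [← integral_const_mul]
    refine integral_congr_ae ?_
    rw [map_smul]
    filter_upwards [Lp.coeFn_smul r (toL2 Ω w)] with x hx
    rw [hx, Pi.smul_apply, convTerm_smul_right]

end Plane

theorem convTerm_gradMat (a : Vec d) (ψ : Vec d → Vec d) (x : Vec d) (b : Vec d) :
    convTerm a (gradMat ψ x) b =
      ∑ j, a j * inner ℝ (fderiv ℝ ψ x (EuclideanSpace.single j 1)) b := by
  unfold convTerm
  rw [Finset.sum_comm]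
  refine Finset.sum_congr rfl fun j _ => ?_
  rw [PiLp.inner_apply, Finset.mul_sum]
  refine Finset.sum_congr rfl fun i _ => ?_
  simp [gradMat_apply]; ring

/-- Antisymmetry of the convection term on smooth fields: `∫ φ · ∇(ψ · χ) = 0` if
`div φ = 0`. -/
theorem integral_convTerm_add_eq_zero {φ ψ χ : Vec d → Vec d} (hφ : IsTestField Ω φ)
    (hψ : IsTestField Ω ψ) (hχ : IsTestField Ω χ) :
    ∫ x, (convTerm (φ x) (gradMat ψ x) (χ x) + convTerm (φ x) (gradMat χ x) (ψ x)) = 0 := by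
  set p : Vec d → ℝ := fun x => inner ℝ (ψ x) (χ x) with hp
  have hpsm : ContDiff ℝ ∞ p := hψ.smooth.inner ℝ hχ.smooth
  have hpd : Differentiable ℝ p := hpsm.differentiable (by simp)
  have hpf : Continuous (fderiv ℝ p) := hpsm.continuous_fderiv (by simp)
  have hφj : ∀ j x h, fderiv ℝ (fun x => φ x j) x h = fderiv ℝ φ x h j := by
    intro j x h
    have h1 : HasFDerivAt (fun x => φ x j)
        ((EuclideanSpace.proj j : Vec d →L[ℝ] ℝ).comp (fderiv ℝ φ x)) x :=
      (EuclideanSpace.proj j : Vec d →L[ℝ] ℝ).hasFDerivAt.comp x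
        (hφ.differentiable x).hasFDerivAt
    rw [h1.fderiv]; rfl
  have hφjd : ∀ j, Differentiable ℝ fun x => φ x j := fun j =>
    (EuclideanSpace.proj j : Vec d →L[ℝ] ℝ).differentiable.comp hφ.differentiable
  have hφc : Continuous φ := hφ.smooth.continuous
  have hφjc : ∀ j, Continuous fun x => φ x j := fun j => (hφjd j).continuous
  have hcs : ∀ j, HasCompactSupport fun x => φ x j := fun j =>
    hφ.compact.comp_left (g := fun y : Vec d => y j) (by simp)
  have hpt : ∀ x, convTerm (φ x) (gradMat ψ x) (χ x) + convTerm (φ x) (gradMat χ x) (ψ x) =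
      ∑ j, φ x j * fderiv ℝ p x (EuclideanSpace.single j 1) := by
    intro x
    rw [convTerm_gradMat, convTerm_gradMat, ← Finset.sum_add_distrib]
    refine Finset.sum_congr rfl fun j _ => ?_
    rw [hp, fderiv_inner_apply ℝ (hψ.differentiable x) (hχ.differentiable x),
      real_inner_comm (ψ x)]
    ring
  have hint : ∀ j, Integrable fun x => φ x j * fderiv ℝ p x (EuclideanSpace.single j 1) :=
    fun j => ((hφjc j).mul (hpf.clm_apply continuous_const)).integrable_of_hasCompactSupport
      (hcs j).mul_right
  have hfc := hφ.continuous_fderiv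
  have hcs' : ∀ j, HasCompactSupport fun x => fderiv ℝ φ x (EuclideanSpace.single j 1) j :=
    fun j => (hφ.compact.fderiv (𝕜 := ℝ)).comp_left
      (g := fun L : Vec d →L[ℝ] Vec d => L (EuclideanSpace.single j 1) j) (by simp)
  have hint' : ∀ j, Integrable fun x => fderiv ℝ φ x (EuclideanSpace.single j 1) j * p x := by
    intro j
    refine Continuous.integrable_of_hasCompactSupport ?_ (hcs' j).mul_right
    have := hpd.continuous
    fun_prop
  simp only [hpt]
  rw [integral_finsetSum _ fun j _ => hint j]
  have hparts : ∀ j, ∫ x, φ x j * fderiv ℝ p x (EuclideanSpace.single j 1) =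
      -∫ x, fderiv ℝ φ x (EuclideanSpace.single j 1) j * p x := by
    intro j
    rw [integral_mul_fderiv_eq_neg_fderiv_mul_of_integrable]
    · simp only [hφj]
    · simpa only [hφj] using hint' j
    · exact hint j
    · exact ((hφjc j).mul hpd.continuous).integrable_of_hasCompactSupport (hcs j).mul_right
    · exact fun x _ => hφjd j x
    · exact fun x _ => hpd x
  simp only [hparts]
  rw [Finset.sum_neg_distrib, ← integral_finsetSum _ fun j _ => hint' j, neg_eq_zero]
  refine integral_eq_zero_of_ae (Eventually.of_forall fun x => ?_)
  have := hφ.div_free x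
  simp only [divergence, gradMat_apply] at this
  simp [← Finset.sum_mul, this]

/-- In the plane the trilinear form is antisymmetric in its last two arguments. -/
theorem formB_antisymm {Ω : Set (Vec 2)} (u v w : VSp Ω) : formB u v w = -formB u w v := by
  have htest : ∀ u φ, IsTestRep Ω u φ → ∀ v ψ, IsTestRep Ω v ψ → ∀ w χ, IsTestRep Ω w χ →
      formB u v w + formB u w v = 0 := by
    intro u φ hu v ψ hv w χ hw
    rw [formB_eq, formB_eq, ← integral_add (integrable_convTerm u v w) (integrable_convTerm u w v)]
    calc _ = ∫ x in Ω, (convTerm (φ x) (gradMat ψ x) (χ x) +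
            convTerm (φ x) (gradMat χ x) (ψ x)) := by
          refine integral_congr_ae ?_
          filter_upwards [hu.field_eq, hv.field_eq, hw.field_eq, hv.grad_eq, hw.grad_eq]
            with x h1 h2 h3 h4 h5
          rw [h1, h2, h3, h4, h5]
      _ = ∫ x, (convTerm (φ x) (gradMat ψ x) (χ x) + convTerm (φ x) (gradMat χ x) (ψ x)) := by
          refine setIntegral_eq_integral_of_forall_compl_eq_zero fun x hx => ?_
          have : φ x = 0 := by
            by_contra h
            exact hx (hu.test.support_subset (subset_tsupport φ h))
          simp [this, convTerm]
      _ = 0 := integral_convTerm_add_eq_zero hu.test hv.test hw.test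
  -- density, one argument after the other
  have h1 : ∀ u φ, IsTestRep Ω u φ → ∀ v ψ, IsTestRep Ω v ψ → ∀ w,
      formB u v w + formB u w v = 0 := fun u φ hu v ψ hv =>
    eq_zero_of_testRep ((isBoundedLinearMap_formB_right u v).add
      (isBoundedLinearMap_formB_mid u v)).toContinuousLinearMap (htest u φ hu v ψ hv)
  have h2 : ∀ u φ, IsTestRep Ω u φ → ∀ w v, formB u v w + formB u w v = 0 := fun u φ hu w =>
    eq_zero_of_testRep ((isBoundedLinearMap_formB_mid u w).add
      (isBoundedLinearMap_formB_right u w)).toContinuousLinearMap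
      fun v ψ hv => h1 u φ hu v ψ hv w
  have h3 : ∀ u, formB u v w + formB u w v = 0 :=
    eq_zero_of_testRep ((isBoundedLinearMap_formB_left v w).add
      (isBoundedLinearMap_formB_left w v)).toContinuousLinearMap
      fun u φ hu => h2 u φ hu w v
  linarith [h3 u]

theorem formB_self {Ω : Set (Vec 2)} (u v : VSp Ω) : formB u v v = 0 := by
  linarith [formB_antisymm u v v]

/-- In the plane the convection term `B(u, u)` belongs to `V'`, with norm at most
`C ‖u‖_H ‖u‖_V`. Antisymmetry moves the derivative to the test function, so that both factors `u`
are measured in `L⁴`. -/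
theorem exists_abs_formB_self_le (Ω : Set (Vec 2)) : ∃ C : ℝ, 0 ≤ C ∧ ∀ u v : VSp Ω,
    |formB u u v| ≤ C * ‖toL2 Ω u‖ * normV u * ‖v‖ := by
  obtain ⟨C, hC⟩ := exists_ladyzhenskaya Ω
  refine ⟨C, C.2, fun u v => ?_⟩
  have h2 : ‖grad Ω v‖ₑ ≤ ‖v‖ₑ := enorm_le_iff_norm_le.2 (norm_grad_le v)
  have h : ‖formB u v u‖ₑ ≤ C * ‖toL2 Ω u‖ₑ * ‖grad Ω u‖ₑ * ‖v‖ₑ := by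
    refine (enorm_formB_le u v u).trans ?_
    rw [← sq]
    gcongr
    exact hC u
  have h3 := ENNReal.toReal_mono (by finiteness) h
  simp only [ENNReal.toReal_mul, toReal_enorm, ENNReal.coe_toReal] at h3
  rw [formB_antisymm, abs_neg]
  exact h3

end

/-! ### Testing the time derivative -/

section

theorem contDiff_smoothTransition : ContDiff ℝ ∞ Real.smoothTransition :=
  Real.smoothTransition.contDiff

theorem deriv_smoothTransition_of_nonpos {x : ℝ} (hx : x ≤ 0) :
    deriv Real.smoothTransition x = 0 :=
  IsLocalMin.deriv_eq_zero (Eventually.of_forall fun y => by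
    rw [Real.smoothTransition.zero_of_nonpos hx]; exact Real.smoothTransition.nonneg y)

theorem deriv_smoothTransition_of_one_le {x : ℝ} (hx : 1 ≤ x) :
    deriv Real.smoothTransition x = 0 :=
  IsLocalMax.deriv_eq_zero (Eventually.of_forall fun y => by
    rw [Real.smoothTransition.one_of_one_le hx]; exact Real.smoothTransition.le_one y)

theorem continuous_deriv_smoothTransition : Continuous (deriv Real.smoothTransition) :=
  contDiff_smoothTransition.continuous_deriv (by simp)

theorem integral_deriv_smoothTransition :
    ∫ x in (0 : ℝ)..1, deriv Real.smoothTransition x = 1 := by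
  rw [intervalIntegral.integral_deriv_eq_sub
    (fun x _ => (contDiff_smoothTransition.differentiable (by simp)) x)
    (continuous_deriv_smoothTransition.intervalIntegrable _ _)]
  simp

/-- The derivatives of the steps `τ ↦ smoothTransition (c (τ - s))` are an approximate identity
at `s`. -/
theorem tendsto_integral_deriv_smoothTransition {p : ℝ → ℝ} (hp : ContinuousOn p (Ioi 0)) {s : ℝ}
    (hs : 0 < s) :
    Tendsto (fun n : ℕ => ∫ τ in Ioi (0 : ℝ), ((n : ℝ) + 1) *
      deriv Real.smoothTransition (((n : ℝ) + 1) * τ - ((n : ℝ) + 1) * s) * p τ) atTop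
      (𝓝 (p s)) := by
  set θ := deriv Real.smoothTransition with hθ
  have hθc : Continuous θ := continuous_deriv_smoothTransition
  have hrw : ∀ n : ℕ, ∫ τ in Ioi (0 : ℝ), ((n : ℝ) + 1) *
      θ (((n : ℝ) + 1) * τ - ((n : ℝ) + 1) * s) * p τ =
      ∫ x in (0 : ℝ)..1, θ x * p (s + x / ((n : ℝ) + 1)) := by
    intro n
    set c : ℝ := (n : ℝ) + 1 with hc
    have hc0 : 0 < c := by positivity
    have hle : s ≤ s + 1 / c := by simp [hc0.le]
    have h1 : ∫ τ in Ioi (0 : ℝ), c * θ (c * τ - c * s) * p τ =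
        ∫ τ in Ioc s (s + 1 / c), c * θ (c * τ - c * s) * p τ := by
      refine setIntegral_eq_of_subset_of_forall_sdiff_eq_zero measurableSet_Ioi
        (fun τ hτ => hs.trans hτ.1) fun τ hτ => ?_
      have : θ (c * τ - c * s) = 0 := by
        rcases le_or_gt τ s with h | h
        · exact deriv_smoothTransition_of_nonpos (by nlinarith)
        · have h2 : s + 1 / c < τ := not_le.1 fun h3 => hτ.2 ⟨h, h3⟩
          refine deriv_smoothTransition_of_one_le ?_
          have h3 : 1 / c < τ - s := by linarith
          rw [div_lt_iff₀ hc0] at h3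
          nlinarith
      simp [this]
    rw [h1, ← intervalIntegral.integral_of_le hle]
    have h2 := intervalIntegral.smul_integral_comp_mul_sub (a := s) (b := s + 1 / c)
      (fun x => θ x * p (s + x / c)) c (c * s)
    have e1 : c * s - c * s = 0 := by ring
    have e2 : c * (s + 1 / c) - c * s = 1 := by field_simp; ring
    rw [e1, e2, smul_eq_mul, ← intervalIntegral.integral_const_mul] at h2
    rw [← h2]
    refine intervalIntegral.integral_congr fun τ _ => ?_
    have e3 : s + (c * τ - c * s) / c = τ := by field_simp; ring
    simp only [e3]; ring
  simp only [hrw]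
  have hlim : ∫ x in (0 : ℝ)..1, θ x * p s = p s := by
    rw [intervalIntegral.integral_mul_const, integral_deriv_smoothTransition, one_mul]
  have hsub : Icc s (s + 1) ⊆ Ioi 0 := fun x hx => hs.trans_le hx.1
  obtain ⟨P, hP⟩ := isCompact_Icc.exists_bound_of_continuousOn (hp.mono hsub)
  have hmem : ∀ n : ℕ, ∀ x ∈ Icc (0 : ℝ) 1, s + x / ((n : ℝ) + 1) ∈ Icc s (s + 1) := by
    intro n x hx
    have hc1 : (1 : ℝ) ≤ (n : ℝ) + 1 := by simp
    have h1 : 0 ≤ x / ((n : ℝ) + 1) := div_nonneg hx.1 (by linarith)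
    have h2 : x / ((n : ℝ) + 1) ≤ 1 := (div_le_one (by linarith)).2 (hx.2.trans hc1)
    exact ⟨by linarith, by linarith⟩
  rw [← hlim]
  refine intervalIntegral.tendsto_integral_filter_of_dominated_convergence (fun x => |θ x| * P)
    (Eventually.of_forall fun n => ?_) (Eventually.of_forall fun n => Eventually.of_forall
    fun x hx => ?_) ((hθc.abs.mul continuous_const).intervalIntegrable _ _)
    (Eventually.of_forall fun x hx => ?_)
  · rw [uIoc_of_le zero_le_one]
    have hcont : ContinuousOn (fun x => θ x * p (s + x / ((n : ℝ) + 1))) (Icc 0 1) :=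
      hθc.continuousOn.mul (hp.comp (by fun_prop) fun x hx => hsub (hmem n x hx))
    exact (hcont.mono Ioc_subset_Icc_self).aestronglyMeasurable measurableSet_Ioc
  · rw [uIoc_of_le zero_le_one] at hx
    rw [norm_mul, Real.norm_eq_abs]
    gcongr
    exact hP _ (hmem n x (Ioc_subset_Icc_self hx))
  · refine Tendsto.const_mul _ ?_
    refine (hp.continuousAt (Ioi_mem_nhds hs)).tendsto.comp ?_
    have := tendsto_const_div_atTop_nhds_zero_nat x
    have h2 : Tendsto (fun n : ℕ => s + x / ((n : ℝ) + 1)) atTop (𝓝 (s + 0)) := by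
      refine tendsto_const_nhds.add ?_
      have := (tendsto_add_atTop_iff_nat 1).2 this
      simpa using this
    simpa using h2

/-- The lemma of du Bois-Reymond: a continuous function whose distributional derivative is the
locally integrable `q` is a primitive of `q`. -/
theorem sub_eq_integral_of_weakDeriv {p q : ℝ → ℝ} (hp : ContinuousOn p (Ioi 0))
    (hq : LocallyIntegrableOn q (Ioi 0))
    (h : ∀ η : ℝ → ℝ, ContDiff ℝ ∞ η → HasCompactSupport η → tsupport η ⊆ Ioi 0 →
      ∫ t in Ioi (0 : ℝ), deriv η t * p t = -∫ t in Ioi (0 : ℝ), η t * q t)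
    {s t : ℝ} (hs : 0 < s) (hst : s ≤ t) : p t - p s = ∫ τ in s..t, q τ := by
  -- smooth approximations `η n` of the indicator of `(s, t]`, as differences of smooth steps
  set χ : ℕ → ℝ → ℝ → ℝ := fun n s τ =>
    Real.smoothTransition (((n : ℝ) + 1) * τ - ((n : ℝ) + 1) * s) with hχ
  have hχsm : ∀ n s, ContDiff ℝ ∞ (χ n s) := fun n s =>
    contDiff_smoothTransition.comp (by fun_prop)
  have hχd : ∀ n s τ, HasDerivAt (χ n s) (((n : ℝ) + 1) *
      deriv Real.smoothTransition (((n : ℝ) + 1) * τ - ((n : ℝ) + 1) * s)) τ := by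
    intro n s τ
    have h1 : HasDerivAt (fun τ => ((n : ℝ) + 1) * τ - ((n : ℝ) + 1) * s) ((n : ℝ) + 1) τ := by
      simpa using ((hasDerivAt_id τ).const_mul ((n : ℝ) + 1)).sub_const (((n : ℝ) + 1) * s)
    have h2 := ((contDiff_smoothTransition.differentiable (by simp))
      (((n : ℝ) + 1) * τ - ((n : ℝ) + 1) * s)).hasDerivAt
    rw [mul_comm]
    exact h2.comp τ h1
  have hχ0 : ∀ n s τ, τ ≤ s → χ n s τ = 0 := fun n s τ hτ =>
    Real.smoothTransition.zero_of_nonpos (by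
      have : (0 : ℝ) < (n : ℝ) + 1 := by positivity
      nlinarith)
  have hχ1 : ∀ (n : ℕ) (s τ : ℝ), 1 ≤ ((n : ℝ) + 1) * (τ - s) → χ n s τ = 1 := fun n s τ hτ =>
    Real.smoothTransition.one_of_one_le (by linarith)
  have hχlim : ∀ s τ, s < τ → Tendsto (fun n => χ n s τ) atTop (𝓝 1) := by
    intro s τ hτ
    refine tendsto_const_nhds.congr' ?_
    obtain ⟨N, hN⟩ := exists_nat_gt (1 / (τ - s))
    filter_upwards [eventually_ge_atTop N] with n hn
    refine (hχ1 n s τ ?_).symm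
    have h1 : 0 < τ - s := by linarith
    rw [div_lt_iff₀ h1] at hN
    have : (N : ℝ) ≤ n := by exact_mod_cast hn
    nlinarith
  set η : ℕ → ℝ → ℝ := fun n τ => χ n s τ - χ n t τ with hη
  have hηsm : ∀ n, ContDiff ℝ ∞ (η n) := fun n => (hχsm n s).sub (hχsm n t)
  have hηsupp : ∀ n, Function.support (η n) ⊆ Icc s (t + 1) := by
    intro n τ hτ
    by_contra hcon
    apply hτ
    have hn : (0 : ℝ) ≤ n := by positivity
    rcases lt_or_ge τ s with h1 | h1
    · simp [hη, hχ0 n s τ h1.le, hχ0 n t τ (h1.le.trans hst)]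
    · have h2 : t + 1 < τ := not_le.1 fun h3 => hcon ⟨h1, h3⟩
      simp [hη, hχ1 n s τ (by nlinarith), hχ1 n t τ (by nlinarith)]
  have hηts : ∀ n, tsupport (η n) ⊆ Icc s (t + 1) := fun n =>
    closure_minimal (hηsupp n) isClosed_Icc
  have hsub : Icc s (t + 1) ⊆ Ioi 0 := fun x hx => hs.trans_le hx.1
  have hηcs : ∀ n, HasCompactSupport (η n) := fun n =>
    isCompact_Icc.of_isClosed_subset (isClosed_tsupport _) (hηts n)
  have key : ∀ n, ∫ τ in Ioi (0 : ℝ), deriv (η n) τ * p τ = -∫ τ in Ioi (0 : ℝ), η n τ * q τ :=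
    fun n => h _ (hηsm n) (hηcs n) ((hηts n).trans hsub)
  -- the left-hand sides converge to `p s - p t`
  have hθint : ∀ (n : ℕ) (s : ℝ), 0 < s → IntegrableOn (fun τ => ((n : ℝ) + 1) *
      deriv Real.smoothTransition (((n : ℝ) + 1) * τ - ((n : ℝ) + 1) * s) * p τ) (Ioi 0) := by
    intro n s hs
    have hcont : ContinuousOn (fun τ => ((n : ℝ) + 1) *
        deriv Real.smoothTransition (((n : ℝ) + 1) * τ - ((n : ℝ) + 1) * s) * p τ)
        (Icc s (s + 1)) := by
      have := continuous_deriv_smoothTransition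
      refine ContinuousOn.mul (by fun_prop) (hp.mono fun x hx => hs.trans_le hx.1)
    refine ((integrableOn_iff_integrable_of_support_subset ?_).1
      (hcont.integrableOn_compact isCompact_Icc)).integrableOn
    intro τ hτ
    by_contra hcon
    apply hτ
    have hn : (0 : ℝ) ≤ n := by positivity
    rcases lt_or_ge τ s with h1 | h1
    · simp [deriv_smoothTransition_of_nonpos
        (show ((n : ℝ) + 1) * τ - ((n : ℝ) + 1) * s ≤ 0 by nlinarith)]
    · have h2 : s + 1 < τ := not_le.1 fun h3 => hcon ⟨h1, h3⟩
      simp [deriv_smoothTransition_of_one_le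
        (show 1 ≤ ((n : ℝ) + 1) * τ - ((n : ℝ) + 1) * s by nlinarith)]
  have hL : Tendsto (fun n => ∫ τ in Ioi (0 : ℝ), deriv (η n) τ * p τ) atTop (𝓝 (p s - p t)) := by
    refine ((tendsto_integral_deriv_smoothTransition hp hs).sub
      (tendsto_integral_deriv_smoothTransition hp (hs.trans_le hst))).congr fun n => ?_
    rw [← integral_sub (hθint n s hs) (hθint n t (hs.trans_le hst))]
    refine setIntegral_congr_fun measurableSet_Ioi fun τ _ => ?_
    simp only [hη, ((hχd n s τ).fun_sub (hχd n t τ)).deriv]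
    ring
  -- the right-hand sides converge by dominated convergence
  have hqint : IntegrableOn q (Icc s (t + 1)) :=
    hq.integrableOn_compact_subset hsub isCompact_Icc
  have hR : Tendsto (fun n => ∫ τ in Ioi (0 : ℝ), η n τ * q τ) atTop (𝓝 (∫ τ in s..t, q τ)) := by
    have e1 : ∀ n, ∫ τ in Ioi (0 : ℝ), η n τ * q τ = ∫ τ in Icc s (t + 1), η n τ * q τ := by
      intro n
      refine setIntegral_eq_of_subset_of_forall_sdiff_eq_zero measurableSet_Ioi hsub
        fun τ hτ => ?_
      have : η n τ = 0 := by
        by_contra h1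
        exact hτ.2 (hηsupp n h1)
      simp [this]
    have e2 : ∫ τ in s..t, q τ = ∫ τ in Icc s (t + 1), (Ioc s t).indicator q τ := by
      rw [intervalIntegral.integral_of_le hst, setIntegral_indicator measurableSet_Ioc,
        inter_eq_self_of_subset_right]
      exact fun x hx => ⟨hx.1.le, hx.2.trans (by linarith)⟩
    simp only [e1, e2]
    refine tendsto_integral_filter_of_dominated_convergence (fun τ => |q τ|)
      (Eventually.of_forall fun n => ?_)
      (Eventually.of_forall fun n => Eventually.of_forall fun τ => ?_) hqint.abs
      (Eventually.of_forall fun τ => ?_)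
    · exact (hηsm n).continuous.aestronglyMeasurable.mul hqint.aestronglyMeasurable
    · rw [norm_mul]
      refine mul_le_of_le_one_left (abs_nonneg _) ?_
      rw [Real.norm_eq_abs, abs_le]
      have a1 := Real.smoothTransition.nonneg (((n : ℝ) + 1) * τ - ((n : ℝ) + 1) * s)
      have a2 := Real.smoothTransition.le_one (((n : ℝ) + 1) * τ - ((n : ℝ) + 1) * s)
      have a3 := Real.smoothTransition.nonneg (((n : ℝ) + 1) * τ - ((n : ℝ) + 1) * t)
      have a4 := Real.smoothTransition.le_one (((n : ℝ) + 1) * τ - ((n : ℝ) + 1) * t)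
      simp only [hη, hχ]
      constructor <;> linarith
    · rcases le_or_gt τ s with h1 | h1
      · have : τ ∉ Ioc s t := fun h2 => absurd h2.1 (not_lt.2 h1)
        simp [this, hη, hχ0 _ s τ h1, hχ0 _ t τ (h1.trans hst)]
      · rcases le_or_gt τ t with h2 | h2
        · rw [indicator_of_mem (show τ ∈ Ioc s t from ⟨h1, h2⟩)]
          have := (hχlim s τ h1).mul_const (q τ)
          simpa [hη, hχ0 _ t τ h2] using this
        · rw [indicator_of_notMem (show τ ∉ Ioc s t from fun h3 => absurd h3.2 (not_le.2 h2))]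
          have := ((hχlim s τ h1).sub (hχlim t τ h2)).mul_const (q τ)
          simpa [hη] using this
  have := tendsto_nhds_unique (hL.congr key) hR.neg
  linarith

theorem integrable_smul_of_hasCompactSupport {E : Type*} [NormedAddCommGroup E] [NormedSpace ℝ E]
    {g : ℝ → E} {η : ℝ → ℝ} (hg : LocallyIntegrableOn g (Ioi 0)) (hη : Continuous η)
    (hcs : HasCompactSupport η) (hsub : tsupport η ⊆ Ioi 0) :
    Integrable fun t => η t • g t := by
  refine (integrableOn_iff_integrable_of_support_subset (s := tsupport η) fun t ht => ?_).1
    ((hg.integrableOn_compact_subset hsub hcs).continuousOn_smul hη.continuousOn hcs)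
  refine subset_tsupport η fun h => ht ?_
  simp [h]

variable {d : ℕ} {Ω : Set (Vec d)}

theorem continuous_toVDual : Continuous (toVDual Ω) :=
  ((innerSL ℝ).continuous.comp (toL2 Ω).continuous).clm_comp continuous_const

theorem norm_toVDual_le (u : VSp Ω) : ‖toVDual Ω u‖ ≤ ‖u‖ := by
  refine ContinuousLinearMap.opNorm_le_bound _ (norm_nonneg _) fun v => ?_
  calc ‖toVDual Ω u v‖ = |inner ℝ (toL2 Ω u) (toL2 Ω v)| := rfl
    _ ≤ ‖toL2 Ω u‖ * ‖toL2 Ω v‖ := abs_real_inner_le_norm _ _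
    _ ≤ ‖u‖ * ‖v‖ := by gcongr <;> exact norm_toL2_le _

theorem locallyIntegrableOn_of_memLp {E : Type*} [NormedAddCommGroup E] {g : ℝ → E}
    (h : ∀ S : ℝ, 0 < S → MemLp g 2 (volume.restrict (Ioo 0 S))) :
    LocallyIntegrableOn g (Ioi 0) := by
  intro x hx
  have hx' : (0 : ℝ) < x := hx
  refine ⟨Ioo 0 (x + 1), mem_nhdsWithin_of_mem_nhds (Ioo_mem_nhds hx' (by linarith)), ?_⟩
  exact (h (x + 1) (by linarith)).integrable (by norm_num)

/-- The time derivative in the sense of distributions, tested with a fixed `v ∈ V`: since `w` is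
weakly continuous, `(w(t) - w(s), v) = ∫_s^t ⟨u', v⟩` for all times `0 < s ≤ t`. -/
theorem IsWeakSolutionWith.inner_sub_eq_integral {ν : ℝ → ℝ} {f : ℝ → VDual Ω} {u₀ : HSp Ω}
    {u : ℝ → VSp Ω} {w : ℝ → HSp Ω} {u' : ℝ → VDual Ω}
    (hu : IsWeakSolutionWith Ω ν f u₀ u w u') (v : VSp Ω) {s t : ℝ} (hs : 0 < s) (hst : s ≤ t) :
    inner ℝ ((w t : L2Vec Ω) - w s) (toL2 Ω v) = ∫ τ in s..t, u' τ v := by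
  have hui : LocallyIntegrableOn (fun t => toVDual Ω (u t)) (Ioi 0) := by
    refine locallyIntegrableOn_of_memLp fun S hS => (hu.memLp S hS).mono
      (continuous_toVDual.comp_aestronglyMeasurable (hu.memLp S hS).1)
      (Eventually.of_forall fun t => norm_toVDual_le _)
  have hpc : ContinuousOn (fun t => inner ℝ (w t : L2Vec Ω) (toL2 Ω v)) (Ioi 0) :=
    (hu.weakly_continuous ⟨toL2 Ω v, toL2_mem_spaceH v⟩).mono Ioi_subset_Ici_self
  have hqi : LocallyIntegrableOn (fun t => u' t v) (Ioi 0) := by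
    intro x hx
    obtain ⟨U, hU, hi⟩ := hu.deriv_locallyIntegrable x hx
    exact ⟨U, hU, (ContinuousLinearMap.apply ℝ ℝ v).integrable_comp hi⟩
  rw [inner_sub_left]
  refine sub_eq_integral_of_weakDeriv hpc hqi (fun η hη hcs hsub => ?_) hs hst
  have h1 := congrArg (fun L : VDual Ω => L v) (hu.isWeakTimeDeriv η hη hcs hsub)
  have hd : Integrable fun t => deriv η t • toVDual Ω (u t) :=
    integrable_smul_of_hasCompactSupport hui (hη.continuous_deriv (by simp)) hcs.deriv
      (tsupport_deriv_subset.trans hsub)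
  have hg : Integrable fun t => η t • u' t :=
    integrable_smul_of_hasCompactSupport hu.deriv_locallyIntegrable hη.continuous hcs hsub
  simp only [neg_apply] at h1
  rw [ContinuousLinearMap.integral_apply hd.integrableOn,
    ContinuousLinearMap.integral_apply hg.integrableOn] at h1
  simp only [smul_apply, smul_eq_mul] at h1
  rw [← h1]
  refine integral_congr_ae ?_
  filter_upwards [hu.ae_eq] with t ht
  rw [← ht]
  rfl

end

/-! ### The energy inequality of the Lions–Magenes lemma -/

section

/-- Translations are continuous in `L²(ℝ; E)`. -/
theorem tendsto_eLpNorm_translate_sub {E : Type*} [NormedAddCommGroup E] {U : ℝ → E}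
    (hU : MemLp U 2 volume) :
    Tendsto (fun x : ℝ => eLpNorm (fun t => U (t + x) - U t) 2 volume) (𝓝 0) (𝓝 0) := by
  let F : C(ℝ, C(ℝ, ℝ)) := ContinuousMap.curry ⟨fun p : ℝ × ℝ => p.2 + p.1, by fun_prop⟩
  have hF : ∀ x, MeasurePreserving (F x) volume volume := fun x =>
    measurePreserving_add_right volume x
  have h1 : Tendsto (fun x : ℝ => Lp.compMeasurePreserving (F x) (hF x) (hU.toLp U)) (𝓝 0)
      (𝓝 (Lp.compMeasurePreserving (F 0) (hF 0) (hU.toLp U))) :=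
    Filter.Tendsto.compMeasurePreservingLp tendsto_const_nhds (F.continuous.tendsto 0) hF (hF 0)
      (by simp)
  simp only [Lp.toLp_compMeasurePreserving] at h1
  rw [Lp.tendsto_Lp_iff_tendsto_eLpNorm'] at h1
  refine h1.congr fun x => eLpNorm_congr_ae ?_
  filter_upwards [(hU.comp_measurePreserving (hF x)).coeFn_toLp,
    (hU.comp_measurePreserving (hF 0)).coeFn_toLp] with t h2 h3
  simp [h2, h3, F]

theorem lintegral_Ioc_add (F : ℝ → ℝ≥0∞) (t h : ℝ) :
    ∫⁻ τ in Ioc t (t + h), F τ = ∫⁻ σ in Ioc 0 h, F (t + σ) := by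
  rw [← lintegral_indicator measurableSet_Ioc, ← lintegral_indicator measurableSet_Ioc,
    ← lintegral_add_left_eq_self _ t]
  refine lintegral_congr fun σ => ?_
  simp only [indicator, mem_Ioc, lt_add_iff_pos_right, add_le_add_iff_left]

/-- After interchanging the integrals, `τ = t + σ` with `0 < σ ≤ h`, and the inner integral is bounded
by the Cauchy–Schwarz inequality in terms of the translate of `U` by `h - σ ∈ [0, h)`. -/
theorem lintegral_lintegral_translate_le {E F : Type*} [NormedAddCommGroup E]
    [NormedAddCommGroup F] {G : ℝ → F} {U : ℝ → E} (hG : StronglyMeasurable G)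
    (hU : StronglyMeasurable U) {h : ℝ} {ε : ℝ≥0∞}
    (hε : ∀ x ∈ Icc 0 h, eLpNorm (fun t => U (t + x) - U t) 2 volume ≤ ε) :
    ∫⁻ t, ∫⁻ τ in Ioc t (t + h), ‖G τ‖ₑ * ‖U (t + h) - U τ‖ₑ ≤
      eLpNorm G 2 volume * ε * ENNReal.ofReal h := by
  simp only [lintegral_Ioc_add]
  have hmeas : Measurable fun p : ℝ × ℝ => ‖G (p.1 + p.2)‖ₑ * ‖U (p.1 + h) - U (p.1 + p.2)‖ₑ :=
    (hG.comp_measurable (measurable_fst.add measurable_snd)).enorm.mul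
      ((hU.comp_measurable (measurable_fst.add_const h)).sub
        (hU.comp_measurable (measurable_fst.add measurable_snd))).enorm
  rw [lintegral_lintegral_swap hmeas.aemeasurable]
  have key : ∀ σ ∈ Ioc 0 h,
      ∫⁻ t, ‖G (t + σ)‖ₑ * ‖U (t + h) - U (t + σ)‖ₑ ≤ eLpNorm G 2 volume * ε := by
    intro σ hσ
    have hshift : ∫⁻ t, ‖G (t + σ)‖ₑ * ‖U (t + h) - U (t + σ)‖ₑ =
        ∫⁻ t, ‖G t‖ₑ * ‖U (t + (h - σ)) - U t‖ₑ := by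
      rw [← lintegral_add_right_eq_self (fun t => ‖G t‖ₑ * ‖U (t + (h - σ)) - U t‖ₑ) σ]
      refine lintegral_congr fun t => ?_
      rw [show t + σ + (h - σ) = t + h by ring]
    rw [hshift]
    have h1 : eLpNorm (fun t => ‖G t‖ * ‖U (t + (h - σ)) - U t‖) 1 volume ≤
        (1 : NNReal) * eLpNorm G 2 volume *
          eLpNorm (fun t => U (t + (h - σ)) - U t) 2 volume :=
      eLpNorm_le_eLpNorm_mul_eLpNorm'_of_norm hG.aestronglyMeasurable
        ((hU.comp_measurable (measurable_id.add_const (h - σ))).sub hU).aestronglyMeasurable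
        (fun a b => ‖a‖ * ‖b‖) 1 (Eventually.of_forall fun x => by simp)
    rw [eLpNorm_one_eq_lintegral_enorm] at h1
    simp only [enorm_mul, enorm_norm, ENNReal.coe_one, one_mul] at h1
    refine h1.trans ?_
    gcongr
    exact hε _ ⟨by linarith [hσ.2], by linarith [hσ.1]⟩
  calc _ ≤ ∫⁻ _ in Ioc 0 h, eLpNorm G 2 volume * ε := setLIntegral_mono measurable_const key
    _ = _ := by rw [setLIntegral_const, Real.volume_Ioc, sub_zero]

theorem integral_le_toReal_lintegral {α : Type*} [MeasurableSpace α] {μ : Measure α} {f : α → ℝ}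
    (hf : Integrable f μ) {A : ℝ≥0∞} (hA : A ≠ ⊤) (h : ∫⁻ x, ENNReal.ofReal (f x) ∂μ ≤ A) :
    ∫ x, f x ∂μ ≤ A.toReal := by
  rw [integral_eq_lintegral_pos_part_sub_lintegral_neg_part hf]
  have h1 := ENNReal.toReal_mono hA h
  have h2 : 0 ≤ (∫⁻ x, ENNReal.ofReal (-f x) ∂μ).toReal := ENNReal.toReal_nonneg
  linarith

/-- An integrable function is almost everywhere nonincreasing on an interval if the integrals of
the positive parts of its increments of step `h` are `o(h)`. -/
theorem ae_antitone_of_increments {Y : ℝ → ℝ} (hY : Integrable Y) {a b : ℝ}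
    (hK : ∀ ε : ℝ, 0 < ε → ∃ h₀ : ℝ, 0 < h₀ ∧ ∀ h ∈ Ioo 0 h₀, ∃ K : ℝ → ℝ≥0∞,
      ∫⁻ t, K t ≤ ENNReal.ofReal (h * ε) ∧
      ∀ᵐ t, t ∈ Ioo a b → t + h ∈ Ioo a b → ENNReal.ofReal (Y (t + h) - Y t) ≤ K t) :
    ∀ᵐ s, ∀ᵐ r, a < s → s ≤ r → r < b → Y r ≤ Y s := by
  have hderiv : ∀ᵐ x, HasDerivAt (fun x => ∫ t in (0 : ℝ)..x, Y t) (Y x) x := by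
    filter_upwards [_root_.LocallyIntegrable.ae_hasDerivAt_integral hY.locallyIntegrable] with x hx using hx 0
  filter_upwards [hderiv] with s hs
  filter_upwards [hderiv] with r hr has hsr hrb
  set D : ℝ → ℝ := fun x => ∫ t in (0 : ℝ)..x, Y t with hD
  have hYi : ∀ x y, IntervalIntegrable Y volume x y := fun x y => hY.intervalIntegrable
  -- `D (r + h) - D r - (D (s + h) - D s)` is the integral over `(s, r]` of the increment of `Y`
  have hlim : Tendsto (fun h => h⁻¹ • (D (r + h) - D r) - h⁻¹ • (D (s + h) - D s)) (𝓝[>] 0)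
      (𝓝 (Y r - Y s)) :=
    hr.tendsto_slope_zero_right.sub hs.tendsto_slope_zero_right
  refine le_of_forall_pos_le_add fun ε hε => ?_
  obtain ⟨h₀, hh₀, hK⟩ := hK ε hε
  have hbound : ∀ᶠ h in 𝓝[>] (0 : ℝ),
      h⁻¹ • (D (r + h) - D r) - h⁻¹ • (D (s + h) - D s) ≤ ε := by
    have hpos : 0 < min h₀ (b - r) := lt_min hh₀ (by linarith)
    filter_upwards [Ioo_mem_nhdsGT hpos] with h hh
    have hh1 : h < h₀ := hh.2.trans_le (min_le_left _ _)
    have hh2 : h < b - r := hh.2.trans_le (min_le_right _ _)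
    obtain ⟨K, hK1, hK2⟩ := hK h ⟨hh.1, hh1⟩
    have hYh : Integrable fun t => Y (t + h) := hY.comp_add_right h
    have h1 : (D (r + h) - D r) - (D (s + h) - D s) = ∫ t in Ioc s r, (Y (t + h) - Y t) := by
      rw [← intervalIntegral.integral_of_le hsr,
        intervalIntegral.integral_sub hYh.intervalIntegrable (hYi _ _),
        intervalIntegral.integral_comp_add_right (fun t => Y t),
        ← intervalIntegral.integral_interval_sub_left (hYi 0 (r + h)) (hYi 0 (s + h)),
        ← intervalIntegral.integral_interval_sub_left (hYi 0 r) (hYi 0 s)]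
      ring
    have h2 : ∫ t in Ioc s r, (Y (t + h) - Y t) ≤ (ENNReal.ofReal (h * ε)).toReal := by
      refine integral_le_toReal_lintegral (hYh.sub hY).integrableOn ENNReal.ofReal_ne_top ?_
      refine le_trans ?_ ((setLIntegral_le_lintegral (Ioc s r) K).trans hK1)
      refine lintegral_mono_ae ((ae_restrict_iff' measurableSet_Ioc).2 ?_)
      filter_upwards [hK2] with t ht hts
      exact ht ⟨has.trans hts.1, hts.2.trans_lt hrb⟩
        ⟨by linarith [hts.1, hh.1], by linarith [hts.2]⟩
    rw [ENNReal.toReal_ofReal (by nlinarith [hh.1]), ← h1] at h2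
    rw [smul_eq_mul, smul_eq_mul, ← mul_sub, inv_mul_le_iff₀ hh.1]
    exact h2
  linarith [le_of_tendsto hlim hbound]

/-- The energy inequality behind the Lions–Magenes lemma, for strongly measurable functions that
are square integrable on the whole line. -/
theorem ae_energy_le_of_memLp {V H : Type*} [NormedAddCommGroup V] [NormedSpace ℝ V]
    [NormedAddCommGroup H] [InnerProductSpace ℝ H] (j : V →L[ℝ] H) {a b : ℝ}
    {u : ℝ → V} {g : ℝ → StrongDual ℝ V} {w : ℝ → H}
    (hum : StronglyMeasurable u) (hu : MemLp u 2 volume)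
    (hgm : StronglyMeasurable g) (hg : MemLp g 2 volume)
    (huw : ∀ᵐ t, t ∈ Ioo a b → j (u t) = w t)
    (hw : ∀ s t, a < s → s ≤ t → t < b → ∀ v, inner ℝ (w t - w s) (j v) = ∫ τ in s..t, g τ v) :
    ∀ᵐ s, ∀ᵐ r, a < s → s ≤ r → r < b →
      ‖w r‖ ^ 2 ≤ ‖w s‖ ^ 2 + 2 * ∫ τ in s..r, g τ (u τ) := by
  have hgu : Integrable fun τ => g τ (u τ) := by
    have h1 : Integrable fun τ => ‖g τ‖ * ‖u τ‖ := hg.norm.integrable_mul hu.norm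
    have hm : AEStronglyMeasurable (fun τ => g τ (u τ)) volume :=
      isBoundedBilinearMap_apply.continuous.comp_aestronglyMeasurable
        (hgm.aestronglyMeasurable.prodMk hum.aestronglyMeasurable)
    exact h1.mono' hm (Eventually.of_forall fun τ => (g τ).le_opNorm (u τ))
  have hgv : ∀ v, ∀ s t : ℝ, IntervalIntegrable (fun τ => g τ v) volume s t := by
    intro v s t
    have h1 : IntegrableOn g (uIoc s t) :=
      ((hg.locallyIntegrable (by norm_num)).integrableOn_isCompact isCompact_uIcc).mono_set
        uIoc_subset_uIcc
    exact intervalIntegrable_iff.2 ((ContinuousLinearMap.apply ℝ ℝ v).integrable_comp h1)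
  set Φ : ℝ → ℝ := fun t => ∫ τ in a..t, g τ (u τ) with hΦ
  have hΦsub : ∀ s t, Φ t - Φ s = ∫ τ in s..t, g τ (u τ) := fun s t =>
    intervalIntegral.integral_interval_sub_left hgu.intervalIntegrable hgu.intervalIntegrable
  have hΦc : Continuous Φ := intervalIntegral.continuous_primitive
    (fun _ _ => hgu.intervalIntegrable) a
  -- `Y` is the energy minus the work; it is almost everywhere nonincreasing
  set Y : ℝ → ℝ := (Ioo a b).indicator fun t => ‖j (u t)‖ ^ 2 - 2 * Φ t with hY
  have hYint : Integrable Y := by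
    refine (integrable_indicator_iff measurableSet_Ioo).2 (Integrable.sub ?_ ?_)
    · have h1 : MemLp (fun t => j (u t)) 2 volume := j.comp_memLp' hu
      exact (h1.integrable_norm_pow (by norm_num)).integrableOn
    · exact ((continuous_const.mul hΦc).continuousOn.integrableOn_compact
        isCompact_Icc).mono_set Ioo_subset_Icc_self
  have hanti := ae_antitone_of_increments hYint (a := a) (b := b) ?_
  · filter_upwards [hanti, huw] with s hs1 hs2
    filter_upwards [hs1, huw] with r hr1 hr2 has hsr hrb
    have h1 := hr1 has hsr hrb
    have ms : s ∈ Ioo a b := ⟨has, hsr.trans_lt hrb⟩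
    have mr : r ∈ Ioo a b := ⟨has.trans_le hsr, hrb⟩
    rw [hY, indicator_of_mem ms, indicator_of_mem mr, hs2 ms, hr2 mr] at h1
    rw [← hΦsub s r]
    linarith
  intro ε hε
  set M : ℝ≥0∞ := 2 * eLpNorm g 2 volume + 1 with hM
  have hMtop : M ≠ ⊤ := ENNReal.add_ne_top.2 ⟨ENNReal.mul_ne_top (by simp) hg.2.ne, by simp⟩
  have hM0 : 0 < M.toReal := ENNReal.toReal_pos (by simp [hM]) hMtop
  have hδ : 0 < ENNReal.ofReal (ε / M.toReal) := by simpa using div_pos hε hM0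
  obtain ⟨h₀, hh₀, hball⟩ := Metric.eventually_nhds_iff.1
    ((tendsto_eLpNorm_translate_sub hu).eventually_lt_const hδ)
  refine ⟨h₀, hh₀, fun h hh => ⟨fun t => 2 * ∫⁻ τ in Ioc t (t + h), ‖g τ‖ₑ * ‖u (t + h) - u τ‖ₑ,
    ?_, ?_⟩⟩
  · have h1 := lintegral_lintegral_translate_le hgm hum (h := h)
      (ε := ENNReal.ofReal (ε / M.toReal)) fun x hx => (hball (by
        rw [Real.dist_eq, sub_zero, abs_of_nonneg hx.1]; exact hx.2.trans_lt hh.2)).le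
    rw [lintegral_const_mul' _ _ (by simp)]
    calc _ ≤ 2 * (eLpNorm g 2 volume * ENNReal.ofReal (ε / M.toReal) * ENNReal.ofReal h) := by
          gcongr
      _ = 2 * eLpNorm g 2 volume * ENNReal.ofReal (ε / M.toReal) * ENNReal.ofReal h := by ring
      _ ≤ M * ENNReal.ofReal (ε / M.toReal) * ENNReal.ofReal h := by
          gcongr
          exact le_self_add
      _ = ENNReal.ofReal (h * ε) := by
          rw [← ENNReal.ofReal_toReal hMtop, ← ENNReal.ofReal_mul hM0.le,
            ← ENNReal.ofReal_mul (by rw [ENNReal.toReal_ofReal hM0.le]; positivity)]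
          rw [ENNReal.toReal_ofReal hM0.le]
          congr 1
          field_simp
  · have huwh : ∀ᵐ t, t + h ∈ Ioo a b → j (u (t + h)) = w (t + h) :=
      (measurePreserving_add_right volume h).quasiMeasurePreserving.ae huw
    filter_upwards [huw, huwh] with t h1 h2 ht hth
    have hle : t ≤ t + h := by linarith [hh.1]
    rw [hY, indicator_of_mem ht, indicator_of_mem hth, h1 ht, h2 hth]
    have h3 := hw t (t + h) ht.1 hle hth.2 (u (t + h))
    rw [h2 hth] at h3
    -- testing at the final time `t + h` gives the sign that discards `‖w (t + h) - w t‖ ^ 2`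
    have h4 : ‖w (t + h)‖ ^ 2 - ‖w t‖ ^ 2 ≤ 2 * inner ℝ (w (t + h) - w t) (w (t + h)) := by
      have h5 := norm_sub_sq_real (w (t + h)) (w t)
      have h6 : inner ℝ (w (t + h) - w t) (w (t + h)) =
          ‖w (t + h)‖ ^ 2 - inner ℝ (w (t + h)) (w t) := by
        rw [inner_sub_left, real_inner_self_eq_norm_sq, real_inner_comm (w (t + h)) (w t)]
      rw [h6]
      nlinarith [sq_nonneg ‖w (t + h) - w t‖]
    have h5 : (‖w (t + h)‖ ^ 2 - 2 * Φ (t + h)) - (‖w t‖ ^ 2 - 2 * Φ t) ≤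
        2 * ∫ τ in t..(t + h), g τ (u (t + h) - u τ) := by
      have h6 : ∫ τ in t..(t + h), g τ (u (t + h) - u τ) =
          (∫ τ in t..(t + h), g τ (u (t + h))) - ∫ τ in t..(t + h), g τ (u τ) := by
        rw [← intervalIntegral.integral_sub (hgv _ _ _) hgu.intervalIntegrable]
        simp only [map_sub]
      rw [h6, ← h3, ← hΦsub]
      linarith
    refine (ENNReal.ofReal_le_ofReal h5).trans ?_
    rw [ENNReal.ofReal_mul (by norm_num), ENNReal.ofReal_ofNat]
    gcongr
    rw [intervalIntegral.integral_of_le hle]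
    refine (Real.ofReal_le_enorm _).trans ((enorm_integral_le_lintegral_enorm _).trans ?_)
    exact lintegral_mono fun τ => (g τ).le_opENorm _

theorem exists_stronglyMeasurable_extension {E : Type*} [NormedAddCommGroup E] {a b : ℝ}
    {f : ℝ → E} (hf : MemLp f 2 (volume.restrict (Ioo a b))) :
    ∃ F : ℝ → E, StronglyMeasurable F ∧ MemLp F 2 volume ∧ ∀ᵐ t, t ∈ Ioo a b → F t = f t := by
  have hF : MemLp ((Ioo a b).indicator f) 2 volume := (memLp_indicator_iff_restrict
    measurableSet_Ioo).2 hf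
  obtain ⟨F, hFm, hFe⟩ := hF.1
  refine ⟨F, hFm, hF.ae_eq hFe, ?_⟩
  filter_upwards [hFe] with t ht htm
  rw [← ht, indicator_of_mem htm]

/-- The energy inequality behind the Lions–Magenes lemma: if `u ∈ L²(a, b; V)` has a time
derivative `g ∈ L²(a, b; V')`, the latter in the integrated weak sense for the representative `w`
of `u` in the pivot space, then `‖w(r)‖² ≤ ‖w(s)‖² + 2 ∫_s^r ⟨g, u⟩`. -/
theorem ae_energy_le {V H : Type*} [NormedAddCommGroup V] [NormedSpace ℝ V]
    [NormedAddCommGroup H] [InnerProductSpace ℝ H] (j : V →L[ℝ] H) {a b : ℝ}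
    {u : ℝ → V} {g : ℝ → StrongDual ℝ V} {w : ℝ → H}
    (hu : MemLp u 2 (volume.restrict (Ioo a b))) (hg : MemLp g 2 (volume.restrict (Ioo a b)))
    (huw : ∀ᵐ t, t ∈ Ioo a b → j (u t) = w t)
    (hw : ∀ s t, a < s → s ≤ t → t < b → ∀ v, inner ℝ (w t - w s) (j v) = ∫ τ in s..t, g τ v) :
    ∀ᵐ s, ∀ᵐ r, a < s → s ≤ r → r < b →
      ‖w r‖ ^ 2 ≤ ‖w s‖ ^ 2 + 2 * ∫ τ in s..r, g τ (u τ) := by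
  obtain ⟨U, hUm, hU, eU⟩ := exists_stronglyMeasurable_extension hu
  obtain ⟨G, hGm, hG, eG⟩ := exists_stronglyMeasurable_extension hg
  have hmain := ae_energy_le_of_memLp j (a := a) (b := b) (w := w) hUm hU hGm hG ?_ ?_
  · filter_upwards [hmain] with s hs
    filter_upwards [hs] with r hr has hsr hrb
    refine (hr has hsr hrb).trans_eq ?_
    congr 2
    refine intervalIntegral.integral_congr_ae ?_
    filter_upwards [eU, eG] with t h1 h2 ht
    rw [uIoc_of_le hsr] at ht
    have hm : t ∈ Ioo a b := ⟨has.trans ht.1, ht.2.trans_lt hrb⟩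
    rw [h1 hm, h2 hm]
  · filter_upwards [huw, eU] with t h1 h2 ht
    rw [h2 ht, h1 ht]
  · intro s t has hst htb v
    rw [hw s t has hst htb v]
    refine intervalIntegral.integral_congr_ae ?_
    filter_upwards [eG] with τ h1 hτ
    rw [uIoc_of_le hst] at hτ
    rw [h1 ⟨has.trans hτ.1, hτ.2.trans_lt htb⟩]

end

/-! ### The energy inequality in the plane -/

section

theorem frequently_nhdsGT_of_ae {P : ℝ → Prop} (h : ∀ᵐ x, P x) (r : ℝ) :
    ∃ᶠ x in 𝓝[>] r, P x := by
  intro hn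
  obtain ⟨δ, hδ, hsub⟩ := mem_nhdsGT_iff_exists_Ioo_subset.1 hn
  have h0 : volume (Ioo r δ) = 0 :=
    measure_mono_null (fun x hx => hsub hx) (show volume {x | ¬P x} = 0 from h)
  rw [Real.volume_Ioo, ENNReal.ofReal_eq_zero] at h0
  have hδ' : r < δ := hδ
  linarith

theorem intervalIntegrable_of_integrableOn_Ioo {F : ℝ → ℝ}
    (hF : ∀ S : ℝ, 0 < S → IntegrableOn F (Ioo 0 S)) {s t : ℝ} (hs : 0 ≤ s) (ht : 0 ≤ t) :
    IntervalIntegrable F volume s t := by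
  rw [intervalIntegrable_iff]
  refine (hF (max s t + 1) (by positivity)).mono_set fun x hx => ?_
  have h1 : 0 ≤ min s t := le_min hs ht
  exact ⟨h1.trans_lt hx.1, hx.2.trans_lt (by simp)⟩

theorem continuousAt_primitive_of_integrableOn_Ioo {F : ℝ → ℝ}
    (hF : ∀ S : ℝ, 0 < S → IntegrableOn F (Ioo 0 S)) {s r : ℝ} (hs : 0 ≤ s) (hr : 0 < r) :
    ContinuousAt (fun c => ∫ τ in s..c, F τ) r := by
  have h1 : IntervalIntegrable F volume 0 (max s r + 1) :=
    intervalIntegrable_of_integrableOn_Ioo hF le_rfl (by positivity)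
  have h2 : uIcc 0 (max s r + 1) = Icc 0 (max s r + 1) := uIcc_of_le (by positivity)
  have h3 := intervalIntegral.continuousOn_primitive_interval' h1 (a := s)
    (by rw [h2]; exact ⟨hs, by linarith [le_max_left s r]⟩)
  rw [h2] at h3
  exact h3.continuousAt (Icc_mem_nhds hr (by linarith [le_max_right s r]))

variable {d : ℕ} {Ω : Set (Vec d)}

theorem normV_nonneg (v : VSp Ω) : 0 ≤ normV v := norm_nonneg _

theorem formA_self (v : VSp Ω) : formA v v = normV v ^ 2 := real_inner_self_eq_norm_sq _

theorem integrableOn_normV_sq {u : ℝ → VSp Ω}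
    (hu : ∀ S : ℝ, 0 < S → MemLp u 2 (volume.restrict (Ioo 0 S))) (S : ℝ) (hS : 0 < S) :
    IntegrableOn (fun t => normV (u t) ^ 2) (Ioo 0 S) :=
  ((grad Ω).comp_memLp' (hu S hS)).integrable_norm_pow (by norm_num)

theorem integrableOn_dissipation {u : ℝ → VSp Ω} {ν : ℝ → ℝ} {νup : ℝ}
    (hu : ∀ S : ℝ, 0 < S → MemLp u 2 (volume.restrict (Ioo 0 S)))
    (hν : ∀ S : ℝ, 0 < S → IntegrableOn ν (Ioo 0 S)) (hν0 : ∀ t, 0 < t → 0 ≤ ν t)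
    (hνup : ∀ t, 0 < t → ν t ≤ νup) (S : ℝ) (hS : 0 < S) :
    IntegrableOn (fun t => ν t * normV (u t) ^ 2) (Ioo 0 S) := by
  have h1 := integrableOn_normV_sq hu S hS
  refine (h1.const_mul νup).mono' ((hν S hS).aestronglyMeasurable.mul h1.aestronglyMeasurable) ?_
  filter_upwards [ae_restrict_mem measurableSet_Ioo] with t ht
  have h2 := hν0 t ht.1
  rw [Real.norm_eq_abs, abs_of_nonneg (by positivity)]
  gcongr
  exact hνup t ht.1

theorem integrableOn_force {u : ℝ → VSp Ω} {f : ℝ → VDual Ω}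
    (hu : ∀ S : ℝ, 0 < S → MemLp u 2 (volume.restrict (Ioo 0 S)))
    (hf : ∀ S : ℝ, 0 < S → MemLp f 2 (volume.restrict (Ioo 0 S))) (S : ℝ) (hS : 0 < S) :
    IntegrableOn (fun t => f t (u t)) (Ioo 0 S) := by
  have h1 : IntegrableOn (fun t => ‖f t‖ * ‖u t‖) (Ioo 0 S) :=
    (hf S hS).norm.integrable_mul (hu S hS).norm
  refine h1.mono' ?_ (Eventually.of_forall fun t => (f t).le_opNorm (u t))
  exact isBoundedBilinearMap_apply.continuous.comp_aestronglyMeasurable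
    ((hf S hS).1.prodMk (hu S hS).1)

/-- In the plane the time derivative of a weak solution belongs to `L²(0, S; V')`. -/
theorem IsWeakSolutionWith.memLp_deriv {Ω : Set (Vec 2)} {ν : ℝ → ℝ} {νup : ℝ}
    {f : ℝ → VDual Ω} {u₀ : HSp Ω} {u : ℝ → VSp Ω} {w : ℝ → HSp Ω} {u' : ℝ → VDual Ω}
    (hu : IsWeakSolutionWith Ω ν f u₀ u w u')
    (hν0 : ∀ t, 0 < t → 0 ≤ ν t) (hνup : ∀ t, 0 < t → ν t ≤ νup)
    (hf : ∀ S : ℝ, 0 < S → MemLp f 2 (volume.restrict (Ioo 0 S))) (S : ℝ) (hS : 0 < S) :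
    MemLp u' 2 (volume.restrict (Ioo 0 S)) := by
  obtain ⟨C, hC0, hC⟩ := exists_abs_formB_self_le Ω
  obtain ⟨Cw, hCw⟩ := hu.bounded S hS
  have hCw0 : 0 ≤ Cw := (norm_nonneg _).trans (hCw S ⟨hS.le, le_rfl⟩)
  have hνup0 : 0 ≤ νup := (hν0 1 one_pos).trans (hνup 1 one_pos)
  have hm : AEStronglyMeasurable u' (volume.restrict (Ioo 0 S)) :=
    hu.deriv_locallyIntegrable.aestronglyMeasurable.mono_measure
      (Measure.restrict_mono Ioo_subset_Ioi_self le_rfl)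
  have hdom : MemLp (fun t => ‖f t‖ + (νup + C * Cw) * ‖u t‖) 2 (volume.restrict (Ioo 0 S)) :=
    (hf S hS).norm.add ((hu.memLp S hS).norm.const_mul _)
  refine hdom.mono hm ?_
  have hsub : Ioo (0 : ℝ) S ⊆ Ioi 0 := Ioo_subset_Ioi_self
  filter_upwards [ae_restrict_mem measurableSet_Ioo, ae_restrict_of_ae_restrict_of_subset hsub
    hu.equation, ae_restrict_of_ae_restrict_of_subset hsub hu.ae_eq] with t ht heq hw
  refine (ContinuousLinearMap.opNorm_le_bound _ (by positivity) fun v => ?_).trans (le_abs_self _)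
  have h1 : u' t v = f t v - ν t * formA (u t) v - formB (u t) (u t) v := by linarith [heq v]
  have h2 : |f t v| ≤ ‖f t‖ * ‖v‖ := (f t).le_opNorm v
  have h3 : |ν t * formA (u t) v| ≤ νup * ‖u t‖ * ‖v‖ := by
    rw [abs_mul, abs_of_nonneg (hν0 t ht.1), mul_assoc]
    have h4 : |formA (u t) v| ≤ ‖u t‖ * ‖v‖ := (abs_real_inner_le_norm _ _).trans (by
      gcongr <;> exact norm_grad_le _)
    gcongr
    exact hνup t ht.1
  have h4 : |formB (u t) (u t) v| ≤ C * Cw * ‖u t‖ * ‖v‖ := by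
    refine (hC (u t) v).trans ?_
    have h5 : ‖toL2 Ω (u t)‖ ≤ Cw := by
      rw [hw]; exact hCw t ⟨ht.1.le, ht.2.le⟩
    have h6 : normV (u t) ≤ ‖u t‖ := norm_grad_le _
    have h7 := normV_nonneg (u t)
    gcongr
  rw [Real.norm_eq_abs, h1]
  calc _ ≤ |f t v| + |ν t * formA (u t) v| + |formB (u t) (u t) v| :=
        (abs_sub _ _).trans (by gcongr; exact abs_sub _ _)
    _ ≤ _ := by linarith

/-- In the plane every weak solution satisfies the energy inequality. -/
theorem IsWeakSolutionWith.energyInequality {Ω : Set (Vec 2)} {ν : ℝ → ℝ} {νup : ℝ}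
    {f : ℝ → VDual Ω} {u₀ : HSp Ω} {u : ℝ → VSp Ω} {w : ℝ → HSp Ω} {u' : ℝ → VDual Ω}
    (hu : IsWeakSolutionWith Ω ν f u₀ u w u')
    (hν : ∀ S : ℝ, 0 < S → IntegrableOn ν (Ioo 0 S))
    (hν0 : ∀ t, 0 < t → 0 ≤ ν t) (hνup : ∀ t, 0 < t → ν t ≤ νup)
    (hf : ∀ S : ℝ, 0 < S → MemLp f 2 (volume.restrict (Ioo 0 S))) :
    EnergyInequality ν f u w := by
  have hae : ∀ᵐ t, 0 < t → toL2 Ω (u t) = (w t : L2Vec Ω) :=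
    (ae_restrict_iff' measurableSet_Ioi).1 hu.ae_eq
  have heq : ∀ᵐ t, 0 < t → u' t (u t) = f t (u t) - ν t * normV (u t) ^ 2 := by
    filter_upwards [(ae_restrict_iff' measurableSet_Ioi).1 hu.equation] with t h1 ht
    have h2 := h1 ht (u t)
    rw [formA_self, formB_self] at h2
    linarith
  have hS : ∀ N : ℕ, ∀ᵐ s, ∀ᵐ r, 0 < s → s ≤ r → r < (N : ℝ) + 1 →
      ‖(w r : L2Vec Ω)‖ ^ 2 ≤ ‖(w s : L2Vec Ω)‖ ^ 2 + 2 * ∫ τ in s..r, u' τ (u τ) := by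
    intro N
    refine ae_energy_le (toL2 Ω) (hu.memLp _ (by positivity))
      (hu.memLp_deriv hν0 hνup hf _ (by positivity)) ?_ ?_
    · filter_upwards [hae] with t ht htm using ht htm.1
    · exact fun s t hs hst _ v => hu.inner_sub_eq_integral v hs hst
  have hD := integrableOn_dissipation hu.memLp hν hν0 hνup
  have hF := integrableOn_force hu.memLp hf
  refine (ae_restrict_iff' measurableSet_Ioi).2 ?_
  filter_upwards [ae_all_iff.2 hS] with s hs hs0 r hsr
  have hs0' : (0 : ℝ) < s := hs0
  set E : ℝ → ℝ := fun c => ‖w s‖ ^ 2 / 2 + (∫ τ in s..c, f τ (u τ)) -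
    ∫ τ in s..c, ν τ * normV (u τ) ^ 2 with hE
  have hr0 : 0 < r := hs0'.trans_le hsr
  have hEc : ContinuousAt E r :=
    (continuousAt_const.add (continuousAt_primitive_of_integrableOn_Ioo hF hs0'.le hr0)).sub
      (continuousAt_primitive_of_integrableOn_Ioo hD hs0'.le hr0)
  have hgood : ∀ᵐ c, s ≤ c → ‖w c‖ ^ 2 / 2 ≤ E c := by
    filter_upwards [ae_all_iff.2 hs] with c hc hsc
    obtain ⟨N, hN⟩ := exists_nat_gt c
    have h1 := hc N hs0' hsc (by linarith)
    have h2 : ∫ τ in s..c, u' τ (u τ) =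
        (∫ τ in s..c, f τ (u τ)) - ∫ τ in s..c, ν τ * normV (u τ) ^ 2 := by
      rw [← intervalIntegral.integral_sub
        (intervalIntegrable_of_integrableOn_Ioo hF hs0'.le (hs0'.le.trans hsc))
        (intervalIntegrable_of_integrableOn_Ioo hD hs0'.le (hs0'.le.trans hsc))]
      refine intervalIntegral.integral_congr_ae ?_
      filter_upwards [heq] with τ h3 hτ
      rw [uIoc_of_le hsc] at hτ
      exact h3 (hs0'.trans hτ.1)
    rw [h2] at h1
    have e1 : ‖(w c : L2Vec Ω)‖ = ‖w c‖ := rfl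
    have e2 : ‖(w s : L2Vec Ω)‖ = ‖w s‖ := rfl
    rw [e1, e2] at h1
    simp only [hE]
    linarith
  -- weak lower semicontinuity of the norm extends the bound from almost every time to every time
  have hlim : Tendsto (fun c => inner ℝ (w c) (w r) - E c) (𝓝[>] r)
      (𝓝 (inner ℝ (w r) (w r) - E r)) := by
    refine Tendsto.sub ?_ (hEc.tendsto.mono_left nhdsWithin_le_nhds)
    exact ((hu.weakly_continuous (w r)).continuousAt (Ici_mem_nhds hr0)).tendsto.mono_left
      nhdsWithin_le_nhds
  have hfreq : ∃ᶠ c in 𝓝[>] r, inner ℝ (w c) (w r) - E c ≤ ‖w r‖ ^ 2 / 2 := by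
    refine ((frequently_nhdsGT_of_ae hgood r).and_eventually self_mem_nhdsWithin).mono ?_
    rintro c ⟨h1, h2⟩
    have h3 := h1 (hsr.trans (le_of_lt h2))
    have h4 := real_inner_le_norm (w c) (w r)
    nlinarith [sq_nonneg (‖w c‖ - ‖w r‖)]
  have h5 := le_of_tendsto_of_frequently hlim hfreq
  rw [real_inner_self_eq_norm_sq] at h5
  simp only [hE] at h5
  linarith

end

/-! ### Gronwall's lemma from almost every starting time -/

section

/-- Gronwall's lemma for integral inequalities that hold only from almost every starting time, as
is the case of the energy inequality of Leray and Hopf. -/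
theorem gronwall_of_ae {a y : ℝ → ℝ} {m s t K : ℝ} (hst : s ≤ t)
    (ha : IntervalIntegrable a volume s t) (ha0 : ∀ τ, s < τ → 0 ≤ a τ)
    (haK : ∀ τ, s < τ → a τ ≤ K)
    (hay : IntervalIntegrable (fun τ => a τ * y τ) volume s t)
    (hs : ∀ r, s ≤ r → y r ≤ y s + ∫ τ in s..r, (m - a τ * y τ))
    (hae : ∀ᵐ σ, s < σ → ∀ r, σ ≤ r → y r ≤ y σ + ∫ τ in σ..r, (m - a τ * y τ)) :
    y t ≤ Real.exp (-∫ τ in s..t, a τ) * y s +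
      m * ∫ σ in s..t, Real.exp (-∫ τ in σ..t, a τ) := by
  have huIcc : uIcc s t = Icc s t := uIcc_of_le hst
  have hK0 : 0 ≤ K := (ha0 (s + 1) (by linarith)).trans (haK _ (by linarith))
  have hai : ∀ x ∈ Icc s t, ∀ z ∈ Icc s t, IntervalIntegrable a volume x z := fun x hx z hz =>
    ha.mono_set (by rw [huIcc]; exact ordConnected_Icc.uIcc_subset hx hz)
  set A : ℝ → ℝ := fun x => ∫ τ in s..x, a τ with hA
  have hs_mem : s ∈ Icc s t := ⟨le_rfl, hst⟩
  have ht_mem : t ∈ Icc s t := ⟨hst, le_rfl⟩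
  have hAsub : ∀ x ∈ Icc s t, ∀ z ∈ Icc s t, A z - A x = ∫ τ in x..z, a τ := fun x hx z hz =>
    intervalIntegral.integral_interval_sub_left (hai s hs_mem z hz) (hai s hs_mem x hx)
  have hAac : AbsolutelyContinuousOnInterval A s t :=
    ha.absolutelyContinuousOnInterval_intervalIntegral left_mem_uIcc
  have hAc : ContinuousOn A (Icc s t) := huIcc ▸ hAac.continuousOn
  have hA0 : ∀ x ∈ Icc s t, 0 ≤ A x := fun x hx => by
    rw [hA]
    refine intervalIntegral.integral_nonneg_of_ae_restrict hx.1 ?_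
    rw [← restrict_Ioc_eq_restrict_Icc]
    filter_upwards [ae_restrict_mem measurableSet_Ioc] with τ hτ using ha0 τ hτ.1
  have hAdiff : ∀ x ∈ Icc s t, ∀ z ∈ Icc s t, |A z - A x| ≤ K * |z - x| := by
    intro x hx z hz
    rw [hAsub x hx z hz, ← Real.norm_eq_abs]
    refine intervalIntegral.norm_integral_le_of_norm_le_const fun τ hτ => ?_
    have : s < τ := (le_min hx.1 hz.1).trans_lt hτ.1
    rw [Real.norm_eq_abs, abs_of_nonneg (ha0 τ this)]
    exact haK τ this
  -- `x ↦ exp (-x)` is nonexpansive on `[0, ∞)`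
  have hexp : ∀ x z : ℝ, 0 ≤ x → x ≤ z → |Real.exp (-z) - Real.exp (-x)| ≤ z - x := by
    intro x z hx hxz
    have h1 : Real.exp (-z) ≤ Real.exp (-x) := Real.exp_le_exp.2 (by linarith)
    rw [abs_sub_comm, abs_of_nonneg (by linarith)]
    have h2 := Real.add_one_le_exp (-(z - x))
    have h3 : Real.exp (-z) = Real.exp (-(z - x)) * Real.exp (-x) := by
      rw [← Real.exp_add]; ring_nf
    have h4 : Real.exp (-x) ≤ 1 := Real.exp_le_one_iff.2 (by linarith)
    rw [h3]
    nlinarith [Real.exp_pos (-x)]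
  have hEac : AbsolutelyContinuousOnInterval (fun x => Real.exp (-A x)) s t := by
    refine LipschitzOnWith.absolutelyContinuousOnInterval (K := K.toNNReal) ?_
    rw [huIcc]
    refine LipschitzOnWith.of_dist_le_mul fun x hx z hz => ?_
    rw [Real.dist_eq, Real.dist_eq, Real.coe_toNNReal _ hK0]
    refine le_trans ?_ (hAdiff z hz x hx)
    rcases le_total (A x) (A z) with h | h
    · rw [abs_sub_comm, abs_sub_comm (A x), abs_of_nonneg (by linarith : 0 ≤ A z - A x)]
      exact hexp _ _ (hA0 x hx) h
    · rw [abs_of_nonneg (by linarith : 0 ≤ A x - A z)]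
      exact hexp _ _ (hA0 z hz) h
  have hexpi : IntervalIntegrable (fun x => Real.exp (A x)) volume s t :=
    ContinuousOn.intervalIntegrable (by rw [huIcc]; exact hAc.rexp)
  have hBac : AbsolutelyContinuousOnInterval
      (fun x => y s + m * ∫ τ in s..x, Real.exp (A τ)) s t := by
    have h1 := (hexpi.absolutelyContinuousOnInterval_intervalIntegral
      (c := s) left_mem_uIcc).const_mul m
    have h2 : AbsolutelyContinuousOnInterval (fun _ : ℝ => y s) s t :=
      contDiffOn_const.absolutelyContinuousOnInterval
    exact h2.add h1
  -- the solution `ψ` of `ψ' = m - a ψ`, `ψ(s) = y(s)`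
  set ψ : ℝ → ℝ := fun x => Real.exp (-A x) * (y s + m * ∫ τ in s..x, Real.exp (A τ)) with hψ
  have hψac : AbsolutelyContinuousOnInterval ψ s t := hEac.mul hBac
  have hψc : ContinuousOn ψ (Icc s t) := huIcc ▸ hψac.continuousOn
  have hψs : ψ s = y s := by simp [hψ, hA]
  have hψd : ∀ᵐ x, x ∈ Icc s t → deriv ψ x = m - a x * ψ x := by
    filter_upwards [ha.ae_hasDerivAt_integral, hexpi.ae_hasDerivAt_integral] with x h1 h2 hx
    have hx' : x ∈ uIcc s t := by rwa [huIcc]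
    have d1 : HasDerivAt A (a x) x := h1 hx' s left_mem_uIcc
    have d2 := ((h2 hx' s left_mem_uIcc).const_mul m).const_add (y s)
    have d3 := d1.neg.exp.mul d2
    have e1 : Real.exp (-A x) * Real.exp (A x) = 1 := by rw [← Real.exp_add]; simp
    have d4 : deriv ψ x = _ := d3.deriv
    rw [d4]
    simp only [hψ, Pi.neg_apply]
    linear_combination m * e1
  have hψint : ∀ σ ∈ Icc s t, ψ t - ψ σ = ∫ τ in σ..t, (m - a τ * ψ τ) := by
    intro σ hσ
    rw [← (hψac.mono (by
      rw [huIcc]; exact ordConnected_Icc.uIcc_subset hσ ht_mem)).integral_deriv_eq_sub]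
    refine intervalIntegral.integral_congr_ae ?_
    filter_upwards [hψd] with τ h1 hτ
    rw [uIoc_of_le hσ.2] at hτ
    exact h1 ⟨hσ.1.trans hτ.1.le, hτ.2⟩
  have haψ : IntervalIntegrable (fun τ => a τ * ψ τ) volume s t :=
    ha.mul_continuousOn (by rwa [huIcc])
  set q : ℝ → ℝ := fun τ => a τ * (y τ - ψ τ) with hq
  have hqi : IntervalIntegrable q volume s t := by
    have : q = fun τ => a τ * y τ - a τ * ψ τ := by ext τ; simp only [hq]; ring
    rw [this]
    exact hay.sub haψ
  have hqi' : ∀ x ∈ Icc s t, ∀ z ∈ Icc s t, IntervalIntegrable q volume x z := fun x hx z hz =>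
    hqi.mono_set (by rw [huIcc]; exact ordConnected_Icc.uIcc_subset hx hz)
  have hsubset : ∀ σ ∈ Icc s t, uIcc σ t ⊆ uIcc s t := fun σ hσ => by
    rw [huIcc]; exact ordConnected_Icc.uIcc_subset hσ ht_mem
  -- the difference `y - ψ` satisfies the homogeneous inequality
  have hdiff : ∀ σ ∈ Icc s t, (∀ r, σ ≤ r → y r ≤ y σ + ∫ τ in σ..r, (m - a τ * y τ)) →
      y t - ψ t ≤ (y σ - ψ σ) - ∫ τ in σ..t, q τ := by
    intro σ hσ h
    have h1 := h t hσ.2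
    have h2 := hψint σ hσ
    have h3 : ∫ τ in σ..t, q τ =
        (∫ τ in σ..t, (m - a τ * ψ τ)) - ∫ τ in σ..t, (m - a τ * y τ) := by
      rw [← intervalIntegral.integral_sub]
      · refine intervalIntegral.integral_congr fun τ _ => ?_
        simp only [hq]; ring
      · exact intervalIntegrable_const.sub (haψ.mono_set (hsubset σ hσ))
      · exact intervalIntegrable_const.sub (hay.mono_set (hsubset σ hσ))
    linarith
  -- compare at the last good time at which `y ≤ ψ`
  set S : Set ℝ := {σ | σ ∈ Icc s t ∧ y σ ≤ ψ σ ∧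
    ∀ r, σ ≤ r → y r ≤ y σ + ∫ τ in σ..r, (m - a τ * y τ)} with hS
  have hsS : s ∈ S := ⟨hs_mem, hψs.ge, hs⟩
  have hSb : BddAbove S := ⟨t, fun σ hσ => hσ.1.2⟩
  obtain ⟨σ, -, hσlim, hσS⟩ := exists_seq_tendsto_sSup ⟨s, hsS⟩ hSb
  set b := sSup S with hb
  have hbm : b ∈ Icc s t := ⟨le_csSup hSb hsS, csSup_le ⟨s, hsS⟩ fun σ hσ => hσ.1.2⟩
  have hpos : 0 ≤ ∫ τ in b..t, q τ := by
    refine intervalIntegral.integral_nonneg_of_ae_restrict hbm.2 ?_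
    rw [← restrict_Ioc_eq_restrict_Icc]
    refine (ae_restrict_iff' measurableSet_Ioc).2 ?_
    filter_upwards [hae] with τ h1 hτ
    have hsτ : s < τ := hbm.1.trans_lt hτ.1
    refine mul_nonneg (ha0 τ hsτ) (sub_nonneg.2 ?_)
    by_contra hcon
    have : τ ∈ S := ⟨⟨hsτ.le, hτ.2⟩, (not_le.1 hcon).le, h1 hsτ⟩
    exact absurd (le_csSup hSb this) (not_le.2 hτ.1)
  have hPc : ContinuousOn (fun x => ∫ τ in s..x, q τ) (Icc s t) := by
    rw [← huIcc]
    exact intervalIntegral.continuousOn_primitive_interval' hqi left_mem_uIcc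
  have hlim : Tendsto (fun n => ∫ τ in σ n..b, q τ) atTop (𝓝 0) := by
    have h1 : Tendsto (fun n => ∫ τ in s..σ n, q τ) atTop (𝓝 (∫ τ in s..b, q τ)) :=
      (hPc b hbm).tendsto.comp (tendsto_nhdsWithin_iff.2
        ⟨hσlim, Eventually.of_forall fun n => (hσS n).1⟩)
    have h2 := (tendsto_const_nhds (x := ∫ τ in s..b, q τ)).sub h1
    rw [sub_self] at h2
    refine h2.congr fun n => ?_
    exact intervalIntegral.integral_interval_sub_left (hqi' s hs_mem b hbm)
      (hqi' s hs_mem _ (hσS n).1)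
  have hle : ∀ n, y t - ψ t ≤ -∫ τ in σ n..b, q τ := by
    intro n
    have h1 := hdiff (σ n) (hσS n).1 (hσS n).2.2
    have h2 := (hσS n).2.1
    rw [← intervalIntegral.integral_add_adjacent_intervals (hqi' _ (hσS n).1 b hbm)
      (hqi' b hbm t ht_mem)] at h1
    linarith
  have hfin : y t - ψ t ≤ 0 := by
    have := ge_of_tendsto' hlim.neg hle
    simpa using this
  have hψt : ψ t = Real.exp (-∫ τ in s..t, a τ) * y s +
      m * ∫ σ in s..t, Real.exp (-∫ τ in σ..t, a τ) := by
    have h1 : ∫ σ in s..t, Real.exp (-∫ τ in σ..t, a τ) =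
        Real.exp (-A t) * ∫ σ in s..t, Real.exp (A σ) := by
      rw [← intervalIntegral.integral_const_mul]
      refine intervalIntegral.integral_congr fun σ hσ => ?_
      rw [huIcc] at hσ
      rw [← hAsub σ hσ t ht_mem, ← Real.exp_add]
      ring_nf
    rw [h1]
    simp only [hψ, hA]
    ring
  linarith

end

/-! ### Absorption and mean dissipation -/

section

theorem continuousOn_exp_neg_primitive {ν : ℝ → ℝ} {c : ℝ}
    (hν : ∀ S : ℝ, 0 < S → IntegrableOn ν (Ioo 0 S)) {t : ℝ} (ht : 0 ≤ t) :
    ContinuousOn (fun s => Real.exp (-(∫ z in s..t, ν z) / c ^ 2)) (Icc 0 t) := by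
  have h1 : IntervalIntegrable ν volume 0 t :=
    intervalIntegrable_of_integrableOn_Ioo hν le_rfl ht
  have h2 := intervalIntegral.continuousOn_primitive_interval_left (μ := volume) (f := ν)
    (a := 0) (b := t) (by rw [uIcc_of_le ht, integrableOn_Icc_iff_integrableOn_Ioc]; exact h1.1)
  rw [uIcc_of_le ht] at h2
  exact (h2.neg.div_const _).rexp

/-- The integrals defining `Kbar` are at most `c² / ν̲`. -/
theorem integral_exp_le {ν : ℝ → ℝ} {νlow c : ℝ} (hlow : 0 < νlow) (hc : 0 < c)
    (hν : ∀ S : ℝ, 0 < S → IntegrableOn ν (Ioo 0 S)) (hνlow : ∀ t, 0 < t → νlow ≤ ν t)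
    {t : ℝ} (ht : 0 ≤ t) :
    ∫ s in (0 : ℝ)..t, Real.exp (-(∫ z in s..t, ν z) / c ^ 2) ≤ c ^ 2 / νlow := by
  set l : ℝ := νlow / c ^ 2 with hl
  have hl0 : 0 < l := by positivity
  have h1 : ∫ s in (0 : ℝ)..t, Real.exp (-(∫ z in s..t, ν z) / c ^ 2) ≤
      ∫ s in (0 : ℝ)..t, Real.exp (l * s - l * t) := by
    refine intervalIntegral.integral_mono_on ht
      (ContinuousOn.intervalIntegrable (by
        rw [uIcc_of_le ht]; exact continuousOn_exp_neg_primitive hν ht))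
      (Continuous.intervalIntegrable (by fun_prop) _ _) fun s hs => ?_
    refine Real.exp_le_exp.2 ?_
    have h2 : νlow * (t - s) ≤ ∫ z in s..t, ν z := by
      have h3 : ∫ _ in s..t, νlow ≤ ∫ z in s..t, ν z := by
        refine intervalIntegral.integral_mono_ae_restrict hs.2 intervalIntegrable_const
          (intervalIntegrable_of_integrableOn_Ioo hν hs.1 ht) ?_
        rw [← restrict_Ioc_eq_restrict_Icc]
        filter_upwards [ae_restrict_mem measurableSet_Ioc] with z hz
        exact hνlow z (hs.1.trans_lt hz.1)
      rw [intervalIntegral.integral_const, smul_eq_mul] at h3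
      linarith
    rw [neg_div, hl]
    have h4 : νlow * (t - s) / c ^ 2 ≤ (∫ z in s..t, ν z) / c ^ 2 := by gcongr
    have h5 : νlow * (t - s) / c ^ 2 = νlow / c ^ 2 * t - νlow / c ^ 2 * s := by ring
    linarith
  refine h1.trans ?_
  rw [intervalIntegral.integral_comp_mul_sub (fun x => Real.exp x) hl0.ne', integral_exp]
  simp only [sub_self, Real.exp_zero, smul_eq_mul]
  have h6 : l⁻¹ = c ^ 2 / νlow := by rw [hl, inv_div]
  rw [h6]
  exact mul_le_of_le_one_right (by positivity) (by linarith [Real.exp_pos (l * 0 - l * t)])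

theorem integral_exp_nonneg (ν : ℝ → ℝ) (c : ℝ) {t : ℝ} (ht : 0 ≤ t) :
    0 ≤ ∫ s in (0 : ℝ)..t, Real.exp (-(∫ z in s..t, ν z) / c ^ 2) :=
  intervalIntegral.integral_nonneg ht fun _ _ => (Real.exp_pos _).le

theorem isBoundedUnder_integral_exp {ν : ℝ → ℝ} {νlow c : ℝ} (hlow : 0 < νlow) (hc : 0 < c)
    (hν : ∀ S : ℝ, 0 < S → IntegrableOn ν (Ioo 0 S)) (hνlow : ∀ t, 0 < t → νlow ≤ ν t) :
    IsBoundedUnder (· ≤ ·) atTop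
      fun t : ℝ => ∫ s in (0 : ℝ)..t, Real.exp (-(∫ z in s..t, ν z) / c ^ 2) :=
  ⟨c ^ 2 / νlow, eventually_map.2 ((eventually_ge_atTop 0).mono fun _ ht =>
    integral_exp_le hlow hc hν hνlow ht)⟩

theorem Kbar_nonneg {ν : ℝ → ℝ} {νlow c : ℝ} (hlow : 0 < νlow) (hc : 0 < c)
    (hν : ∀ S : ℝ, 0 < S → IntegrableOn ν (Ioo 0 S)) (hνlow : ∀ t, 0 < t → νlow ≤ ν t) :
    0 ≤ Kbar ν c :=
  le_limsup_of_frequently_le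
    ((eventually_ge_atTop 0).mono fun _ ht => integral_exp_nonneg ν c ht).frequently
    (isBoundedUnder_integral_exp hlow hc hν hνlow)

/-- The real-variable core of the argument. Here `y` is the energy, `D` the dissipation and `m`
bounds the work of the force; by Gronwall's lemma the energy is eventually
below `m K̄ + ε`, and the energy balance on `[t, t + T]` then bounds the mean dissipation. -/
theorem eventually_average_le {ν D y : ℝ → ℝ} {νlow νup c m T s₀ : ℝ} (hlow : 0 < νlow)
    (hc : 0 < c) (hm : 0 ≤ m) (hT : 0 < T)
    (hν : ∀ S : ℝ, 0 < S → IntegrableOn ν (Ioo 0 S))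
    (hνlow : ∀ t, 0 < t → νlow ≤ ν t) (hνup : ∀ t, 0 < t → ν t ≤ νup)
    (hD : ∀ S : ℝ, 0 < S → IntegrableOn D (Ioo 0 S))
    (hνy : ∀ S : ℝ, 0 < S → IntegrableOn (fun t => ν t / c ^ 2 * y t) (Ioo 0 S))
    (hy0 : ∀ t, 0 ≤ y t) (hyD : ∀ᵐ t, 0 < t → ν t / c ^ 2 * y t ≤ D t) (hs₀ : 0 ≤ s₀)
    (hE : ∀ᵐ s, s₀ < s → ∀ t, s ≤ t → y t + ∫ τ in s..t, D τ ≤ y s + m * (t - s))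
    {ε : ℝ} (hε : 0 < ε) :
    ∀ᶠ t in atTop, 1 / T * ∫ τ in t..(t + T), D τ ≤ (m * (Kbar ν c + ε) + ε) / T + m := by
  set a : ℝ → ℝ := fun t => ν t / c ^ 2 with ha
  have hν0 : ∀ t, 0 < t → 0 ≤ ν t := fun t ht => hlow.le.trans (hνlow t ht)
  have hai : ∀ S : ℝ, 0 < S → IntegrableOn a (Ioo 0 S) := fun S hS => (hν S hS).div_const _
  -- the energy inequality implies the hypothesis of Gronwall's lemma
  have hG : ∀ᵐ s, s₀ < s → ∀ t, s ≤ t → y t ≤ y s + ∫ τ in s..t, (m - a τ * y τ) := by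
    filter_upwards [hE] with s hs hs0 t hst
    have hs0' : 0 ≤ s := hs₀.trans hs0.le
    have ht0 : 0 ≤ t := hs0'.trans hst
    have h1 := hs hs0 t hst
    have h2 : ∫ τ in s..t, a τ * y τ ≤ ∫ τ in s..t, D τ := by
      refine intervalIntegral.integral_mono_ae_restrict hst
        (intervalIntegrable_of_integrableOn_Ioo hνy hs0' ht0)
        (intervalIntegrable_of_integrableOn_Ioo hD hs0' ht0) ?_
      rw [← restrict_Ioc_eq_restrict_Icc]
      refine (ae_restrict_iff' measurableSet_Ioc).2 ?_
      filter_upwards [hyD] with τ h3 hτ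
      exact h3 (hs0'.trans_lt hτ.1)
    rw [intervalIntegral.integral_sub intervalIntegrable_const
      (intervalIntegrable_of_integrableOn_Ioo hνy hs0' ht0), intervalIntegral.integral_const,
      smul_eq_mul]
    linarith
  -- one good starting time suffices to control the energy at all later times
  obtain ⟨s, hs, hs0⟩ := ((frequently_nhdsGT_of_ae hG s₀).and_eventually
    self_mem_nhdsWithin).exists
  have hs0 : s₀ < s := hs0
  have hspos : 0 < s := hs₀.trans_lt hs0
  have hgron : ∀ t, s ≤ t → y t ≤ Real.exp (-(νlow / c ^ 2 * (t - s))) * y s +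
      m * ∫ σ in (0 : ℝ)..t, Real.exp (-(∫ z in σ..t, ν z) / c ^ 2) := by
    intro t hst
    have ht0 : 0 ≤ t := hspos.le.trans hst
    have h1 := gronwall_of_ae (a := a) (y := y) (m := m) (K := νup / c ^ 2) hst
      (intervalIntegrable_of_integrableOn_Ioo hai hspos.le ht0)
      (fun τ hτ => div_nonneg (hν0 τ (hspos.trans hτ)) (by positivity))
      (fun τ hτ => by simp only [ha]; gcongr; exact hνup τ (hspos.trans hτ))
      (intervalIntegrable_of_integrableOn_Ioo hνy hspos.le ht0) (hs hs0)
      (by filter_upwards [hG] with σ h2 hσ using h2 (hs0.trans hσ))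
    have ha_int : ∀ σ, ∫ τ in σ..t, a τ = (∫ z in σ..t, ν z) / c ^ 2 := fun σ =>
      intervalIntegral.integral_div _ _
    refine h1.trans (add_le_add ?_ ?_)
    · refine mul_le_mul_of_nonneg_right (Real.exp_le_exp.2 (neg_le_neg ?_)) (hy0 s)
      have h3 : ∫ _ in s..t, νlow / c ^ 2 ≤ ∫ τ in s..t, a τ := by
        refine intervalIntegral.integral_mono_ae_restrict hst intervalIntegrable_const
          (intervalIntegrable_of_integrableOn_Ioo hai hspos.le ht0) ?_
        rw [← restrict_Ioc_eq_restrict_Icc]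
        filter_upwards [ae_restrict_mem measurableSet_Ioc] with z hz
        simp only [ha]
        gcongr
        exact hνlow z (hspos.trans hz.1)
      rw [intervalIntegral.integral_const, smul_eq_mul] at h3
      linarith
    · refine mul_le_mul_of_nonneg_left ?_ hm
      simp only [ha_int, ← neg_div]
      have hi : IntervalIntegrable (fun s => Real.exp (-(∫ z in s..t, ν z) / c ^ 2)) volume 0 t :=
        ContinuousOn.intervalIntegrable (by
          rw [uIcc_of_le ht0]; exact continuousOn_exp_neg_primitive hν ht0)
      exact intervalIntegral.integral_mono_interval hspos.le hst le_rfl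
        (Eventually.of_forall fun σ => (Real.exp_pos _).le) hi
  have hdecay : Tendsto (fun t => Real.exp (-(νlow / c ^ 2 * (t - s))) * y s) atTop (𝓝 0) := by
    have h1 : Tendsto (fun t => νlow / c ^ 2 * (t - s)) atTop atTop :=
      (tendsto_atTop_add_const_right _ (-s) tendsto_id).const_mul_atTop (by positivity)
    simpa using (Real.tendsto_exp_neg_atTop_nhds_zero.comp h1).mul_const (y s)
  have hK : ∀ᶠ t : ℝ in atTop, ∫ σ in (0 : ℝ)..t, Real.exp (-(∫ z in σ..t, ν z) / c ^ 2) <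
      Kbar ν c + ε :=
    eventually_lt_of_limsup_lt (by simp only [Kbar]; linarith)
      (isBoundedUnder_integral_exp hlow hc hν hνlow)
  have hy : ∀ᶠ t in atTop, y t ≤ m * (Kbar ν c + ε) + ε := by
    filter_upwards [hK, hdecay.eventually_lt_const hε, eventually_ge_atTop s] with t h1 h2 h3
    have h4 := hgron t h3
    have h5 : m * ∫ σ in (0 : ℝ)..t, Real.exp (-(∫ z in σ..t, ν z) / c ^ 2) ≤
        m * (Kbar ν c + ε) := by gcongr
    linarith
  obtain ⟨t₁, ht₁⟩ := eventually_atTop.1 hy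
  filter_upwards [eventually_ge_atTop (max t₁ (s₀ + 1))] with t ht
  have htt₁ : t₁ ≤ t := (le_max_left _ _).trans ht
  have hts₀ : s₀ < t := by linarith [(le_max_right t₁ (s₀ + 1)).trans ht]
  have ht0 : 0 < t := hs₀.trans_lt hts₀
  -- the window may start at an exceptional time `t`: start the energy inequality at good times decreasing to `t`
  have hlim : Tendsto (fun σ => ∫ τ in σ..(t + T), D τ) (𝓝[>] t)
      (𝓝 (∫ τ in t..(t + T), D τ)) := by
    have h1 : ContinuousAt (fun σ => ∫ τ in (t + T)..σ, D τ) t :=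
      continuousAt_primitive_of_integrableOn_Ioo hD (by linarith) ht0
    have h2 := (h1.neg.tendsto).mono_left (nhdsWithin_le_nhds (s := Ioi t))
    rw [intervalIntegral.integral_symm (t + T) t]
    exact h2.congr fun σ => (intervalIntegral.integral_symm _ _).symm
  have hfreq : ∃ᶠ σ in 𝓝[>] t, ∫ τ in σ..(t + T), D τ ≤ m * (Kbar ν c + ε) + ε + m * T := by
    refine ((frequently_nhdsGT_of_ae hE t).and_eventually
      (Ioo_mem_nhdsGT (show t < t + T by linarith))).mono ?_
    rintro σ ⟨h1, h2⟩
    have h3 := h1 (hts₀.trans h2.1) (t + T) h2.2.le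
    have h4 := ht₁ σ (htt₁.trans h2.1.le)
    have h5 := hy0 (t + T)
    have h6 : m * (t + T - σ) ≤ m * T := by
      gcongr
      linarith [h2.1]
    linarith
  have hfin := le_of_tendsto_of_frequently hlim hfreq
  calc _ ≤ 1 / T * (m * (Kbar ν c + ε) + ε + m * T) := by gcongr
    _ = _ := by field_simp

variable {d : ℕ} {Ω : Set (Vec d)}

/-- A bound for `normVDual` bounds the pairing with every element of `V`; the Poincaré
inequality excludes nonzero elements with `‖v‖_V = 0`. -/
theorem apply_le_of_normVDual_sq_le {c : ℝ} (hP : ∀ v : VSp Ω, ‖toL2 Ω v‖ ≤ c * normV v)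
    {f : VDual Ω} {M : ℝ} (hM : 0 ≤ M) (hf : normVDual f ^ 2 ≤ ENNReal.ofReal M) (v : VSp Ω) :
    f v ≤ √M * normV v := by
  rcases (normV_nonneg v).eq_or_lt with h0 | h0
  · have h1 : ‖toL2 Ω v‖ = 0 := le_antisymm (by simpa [← h0] using hP v) (norm_nonneg _)
    have h2 : ‖v‖ ^ 2 = 0 := by
      rw [norm_sq_eq, h1, show ‖grad Ω v‖ = 0 from h0.symm]; simp
    have h3 : v = 0 := by simpa using h2
    rw [h3, map_zero]
    exact mul_nonneg (Real.sqrt_nonneg _) (normV_nonneg _)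
  · set v₁ : VSp Ω := (normV v)⁻¹ • v with hv₁
    have h1 : normV v₁ ≤ 1 := by
      simp only [normV, hv₁, map_smul, norm_smul, norm_inv, norm_norm]
      exact (inv_mul_cancel₀ h0.ne').le
    have h2 : ‖f v₁‖ₑ ≤ normVDual f :=
      le_iSup (fun v : {v : VSp Ω // normV v ≤ 1} => ‖f v‖ₑ) ⟨v₁, h1⟩
    have h3 : ‖f v₁‖ₑ ^ 2 ≤ ENNReal.ofReal M := (ENNReal.pow_le_pow_left h2).trans hf
    have h4 : f v₁ ≤ √M := by
      refine Real.le_sqrt_of_sq_le ?_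
      rw [← ofReal_norm, ← ENNReal.ofReal_pow (norm_nonneg _), Real.norm_eq_abs, sq_abs] at h3
      exact (ENNReal.ofReal_le_ofReal_iff hM).1 h3
    have h5 : f v = normV v * f v₁ := by
      rw [hv₁, map_smul, smul_eq_mul, mul_inv_cancel_left₀ h0.ne']
    rw [h5, mul_comm]
    gcongr

end

/-! ### The bound for weak solutions -/

section

variable {d : ℕ} {Ω : Set (Vec d)}

/-- Once the force is bounded by `M` in `V'`, Young's inequality absorbs half of the dissipation,
and the energy grows at most at the rate `M / ν̲` minus the dissipation. -/
theorem ae_energy_add_dissipation_le {ν : ℝ → ℝ} {νlow νup c M s₀ : ℝ} {f : ℝ → VDual Ω}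
    {u : ℝ → VSp Ω} {w : ℝ → HSp Ω} (hlow : 0 < νlow)
    (hν : ∀ S : ℝ, 0 < S → IntegrableOn ν (Ioo 0 S))
    (hνlow : ∀ t, 0 < t → νlow ≤ ν t) (hνup : ∀ t, 0 < t → ν t ≤ νup)
    (hu : ∀ S : ℝ, 0 < S → MemLp u 2 (volume.restrict (Ioo 0 S)))
    (hf : ∀ S : ℝ, 0 < S → MemLp f 2 (volume.restrict (Ioo 0 S)))
    (hP : ∀ v : VSp Ω, ‖toL2 Ω v‖ ≤ c * normV v) (hE : EnergyInequality ν f u w)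
    (hM : 0 ≤ M) (hs₀ : 0 ≤ s₀)
    (hfM : ∀ᵐ t, s₀ ≤ t → normVDual (f t) ^ 2 ≤ ENNReal.ofReal M) :
    ∀ᵐ s, s₀ < s → ∀ t, s ≤ t → ‖w t‖ ^ 2 + ∫ τ in s..t, ν τ * normV (u τ) ^ 2 ≤
      ‖w s‖ ^ 2 + M / νlow * (t - s) := by
  have hD := integrableOn_dissipation hu hν (fun t ht => hlow.le.trans (hνlow t ht)) hνup
  have hF := integrableOn_force hu hf
  filter_upwards [(ae_restrict_iff' measurableSet_Ioi).1 hE] with s hs hs0 t hst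
  have hs0' : 0 < s := hs₀.trans_lt hs0
  have ht0 : 0 ≤ t := hs0'.le.trans hst
  have h1 := hs hs0' t hst
  have hDi := intervalIntegrable_of_integrableOn_Ioo hD hs0'.le ht0
  have h2 : ∫ τ in s..t, f τ (u τ) ≤
      ∫ τ in s..t, (M / (2 * νlow) + 1 / 2 * (ν τ * normV (u τ) ^ 2)) := by
    refine intervalIntegral.integral_mono_ae_restrict hst
      (intervalIntegrable_of_integrableOn_Ioo hF hs0'.le ht0)
      (intervalIntegrable_const.add (hDi.const_mul _)) ?_
    rw [← restrict_Ioc_eq_restrict_Icc]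
    refine (ae_restrict_iff' measurableSet_Ioc).2 ?_
    filter_upwards [hfM] with τ h3 hτ
    have h4 := apply_le_of_normVDual_sq_le hP hM (h3 (hs0.le.trans hτ.1.le)) (u τ)
    have h5 : √M * normV (u τ) ≤ M / (2 * νlow) + 1 / 2 * (νlow * normV (u τ) ^ 2) := by
      have h6 : M / (2 * νlow) + 1 / 2 * (νlow * normV (u τ) ^ 2) - √M * normV (u τ) =
          (√M - νlow * normV (u τ)) ^ 2 / (2 * νlow) := by
        have h7 := Real.sq_sqrt hM
        field_simp
        linear_combination -h7
      have h8 : 0 ≤ (√M - νlow * normV (u τ)) ^ 2 / (2 * νlow) := by positivity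
      linarith
    have h9 : νlow * normV (u τ) ^ 2 ≤ ν τ * normV (u τ) ^ 2 := by
      gcongr
      exact hνlow τ (hs0'.trans hτ.1)
    show f τ (u τ) ≤ _
    linarith
  rw [intervalIntegral.integral_add intervalIntegrable_const (hDi.const_mul _),
    intervalIntegral.integral_const, intervalIntegral.integral_const_mul, smul_eq_mul] at h2
  have h3 : M / νlow * (t - s) = 2 * ((t - s) * (M / (2 * νlow))) := by field_simp
  linarith

end

end NSE

theorem lemmaC1 (d : ℕ) (hd : d = 2 ∨ d = 3)
    (Ω : Set (NSE.Vec d)) (hΩo : IsOpen Ω) (hΩb : Bornology.IsBounded Ω)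
    (ν : ℝ → ℝ) (νlow νup : ℝ)
    (hν : ∀ S : ℝ, 0 < S → IntegrableOn ν (Ioo 0 S))
    (hνlow : IsGLB (ν '' Ioi 0) νlow) (hνup : IsLUB (ν '' Ioi 0) νup) (hνpos : 0 < νlow)
    (f : ℝ → NSE.VDual Ω)
    (hf : ∀ S : ℝ, 0 < S → MemLp f 2 (volume.restrict (Ioo 0 S)))
    (u₀ : NSE.HSp Ω) (u : ℝ → NSE.VSp Ω) (hu : NSE.IsWeakSolution Ω ν f u₀ u)
    (c : ℝ) (hc : 0 < c) (hcΩ : NSE.poincareConst Ω ≤ c)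
    (T : ℝ) (hT : c ^ 2 / νlow ≤ T) :
    limsup (fun t : ℝ => ENNReal.ofReal (1 / T) *
        ∫⁻ τ in Ioc t (t + T), ENNReal.ofReal (ν τ * NSE.normV (u τ) ^ 2)) atTop ≤
      ENNReal.ofReal ((NSE.Kbar ν c * νlow + c ^ 2) / (νlow * c ^ 2)) *
        limsup (fun t : ℝ => NSE.normVDual (f t) ^ 2) (atTop ⊓ ae volume) := by
  obtain ⟨w, u', hw, hE3⟩ := hu
  have hlow : ∀ t, 0 < t → νlow ≤ ν t := fun t ht => hνlow.1 ⟨t, ht, rfl⟩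
  have hup : ∀ t, 0 < t → ν t ≤ νup := fun t ht => hνup.1 ⟨t, ht, rfl⟩
  have hν0 : ∀ t, 0 < t → 0 ≤ ν t := fun t ht => hνpos.le.trans (hlow t ht)
  have hE : NSE.EnergyInequality ν f u w := by
    rcases hd with rfl | rfl
    · exact hw.energyInequality hν hν0 hup hf
    · exact hE3 rfl
  have hP := NSE.norm_toL2_le_of_poincareConst_le hd hΩb hcΩ
  have hK := NSE.Kbar_nonneg hνpos hc hν hlow
  have hT0 : 0 < T := lt_of_lt_of_le (by positivity) hT
  set κ : ℝ := (NSE.Kbar ν c * νlow + c ^ 2) / (νlow * c ^ 2) with hκ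
  have hκ0 : 0 < κ := by positivity
  set F := limsup (fun t : ℝ => NSE.normVDual (f t) ^ 2) (atTop ⊓ ae volume) with hF
  by_cases hFtop : F = ⊤
  · rw [hFtop, ENNReal.mul_top (by simpa using hκ0)]
    exact le_top
  have hD := NSE.integrableOn_dissipation hw.memLp hν hν0 hup
  have hD0 : ∀ t, 0 < t → 0 ≤ ν t * NSE.normV (u t) ^ 2 := fun t ht =>
    mul_nonneg (hν0 t ht) (sq_nonneg _)
  have hae : ∀ᵐ t, 0 < t → NSE.toL2 Ω (u t) = (w t : NSE.L2Vec Ω) :=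
    (ae_restrict_iff' measurableSet_Ioi).1 hw.ae_eq
  have hyD : ∀ᵐ t, 0 < t → ν t / c ^ 2 * ‖w t‖ ^ 2 ≤ ν t * NSE.normV (u t) ^ 2 := by
    filter_upwards [hae] with t h1 ht
    have h2 : ‖w t‖ ≤ c * NSE.normV (u t) := by
      have h3 := hP (u t)
      rwa [h1 ht] at h3
    have h4 : ‖w t‖ ^ 2 ≤ (c * NSE.normV (u t)) ^ 2 := by gcongr
    have h5 := hν0 t ht
    calc ν t / c ^ 2 * ‖w t‖ ^ 2 ≤ ν t / c ^ 2 * (c * NSE.normV (u t)) ^ 2 := by gcongr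
      _ = _ := by field_simp
  have hνy : ∀ S : ℝ, 0 < S → IntegrableOn (fun t => ν t / c ^ 2 * ‖w t‖ ^ 2) (Ioo 0 S) := by
    intro S hS
    refine (hD S hS).mono' ?_ ?_
    · have h1 : AEStronglyMeasurable (fun t => ‖NSE.toL2 Ω (u t)‖ ^ 2)
          (volume.restrict (Ioo 0 S)) :=
        (((NSE.toL2 Ω).continuous.comp_aestronglyMeasurable (hw.memLp S hS).1).norm).pow 2
      have h2 : AEStronglyMeasurable (fun t => ‖w t‖ ^ 2) (volume.restrict (Ioo 0 S)) := by
        refine h1.congr ((ae_restrict_iff' measurableSet_Ioo).2 ?_)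
        filter_upwards [hae] with t h3 ht
        rw [h3 ht.1]
        rfl
      exact ((hν S hS).div_const _).aestronglyMeasurable.mul h2
    · refine (ae_restrict_iff' measurableSet_Ioo).2 ?_
      filter_upwards [hyD] with t h1 ht
      have h2 := hν0 t ht.1
      rw [Real.norm_eq_abs, abs_of_nonneg (by positivity)]
      exact h1 ht.1
  set L := limsup (fun t : ℝ => ENNReal.ofReal (1 / T) *
    ∫⁻ τ in Ioc t (t + T), ENNReal.ofReal (ν τ * NSE.normV (u τ) ^ 2)) atTop with hL
  have key : ∀ M : ℝ, F.toReal < M → L ≤ ENNReal.ofReal (κ * M) := by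
    intro M hM
    have hM0 : 0 < M := ENNReal.toReal_nonneg.trans_lt hM
    have hFM : F < ENNReal.ofReal M := (ENNReal.lt_ofReal_iff_toReal_lt hFtop).2 hM
    obtain ⟨A, hA, B, hB, hAB⟩ := eventually_inf.1 (eventually_lt_of_limsup_lt hFM)
    obtain ⟨s₁, hs₁⟩ := mem_atTop_sets.1 hA
    have hfM : ∀ᵐ t, max s₁ 0 ≤ t → NSE.normVDual (f t) ^ 2 ≤ ENNReal.ofReal M := by
      filter_upwards [hB] with t htB ht
      exact (hAB t ⟨hs₁ t ((le_max_left _ _).trans ht), htB⟩).le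
    have hbal := NSE.ae_energy_add_dissipation_le hνpos hν hlow hup hw.memLp hf hP hE hM0.le
      (le_max_right s₁ 0) hfM
    set m : ℝ := M / νlow with hm
    have hm0 : 0 ≤ m := by positivity
    have hε : ∀ ε : ℝ, 0 < ε →
        L ≤ ENNReal.ofReal ((m * (NSE.Kbar ν c + ε) + ε) / T + m) := by
      intro ε hε
      refine limsup_le_of_le (by isBoundedDefault) ?_
      filter_upwards [NSE.eventually_average_le hνpos hc hm0 hT0 hν hlow hup hD hνy
        (fun t => sq_nonneg _) hyD (le_max_right s₁ 0) hbal hε, eventually_ge_atTop 0]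
        with t ht ht0
      have hDi := NSE.intervalIntegrable_of_integrableOn_Ioo hD ht0 (by linarith : 0 ≤ t + T)
      rw [← ofReal_integral_eq_lintegral_ofReal hDi.1
        ((ae_restrict_iff' measurableSet_Ioc).2 (Eventually.of_forall fun τ hτ =>
          hD0 τ (ht0.trans_lt hτ.1))),
        ← intervalIntegral.integral_of_le (by linarith), ← ENNReal.ofReal_mul (by positivity)]
      exact ENNReal.ofReal_le_ofReal ht
    have h0 : L ≤ ENNReal.ofReal ((m * (NSE.Kbar ν c + 0) + 0) / T + m) := by
      have hcont : Continuous fun ε : ℝ =>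
          ENNReal.ofReal ((m * (NSE.Kbar ν c + ε) + ε) / T + m) :=
        ENNReal.continuous_ofReal.comp (by fun_prop)
      refine ge_of_tendsto (x := 𝓝[>] (0 : ℝ)) ((hcont.tendsto 0).mono_left nhdsWithin_le_nhds) ?_
      filter_upwards [self_mem_nhdsWithin] with ε hε' using hε ε hε'
    refine h0.trans (ENNReal.ofReal_le_ofReal ?_)
    -- here the condition `T ≥ c² / ν̲` enters
    have h1 : m * NSE.Kbar ν c / T ≤ m * NSE.Kbar ν c / (c ^ 2 / νlow) := by gcongr
    calc (m * (NSE.Kbar ν c + 0) + 0) / T + m = m * NSE.Kbar ν c / T + m := by ring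
      _ ≤ m * NSE.Kbar ν c / (c ^ 2 / νlow) + m := by linarith
      _ = κ * M := by rw [hm, hκ]; field_simp
  have hcont : Continuous fun M : ℝ => ENNReal.ofReal (κ * M) :=
    ENNReal.continuous_ofReal.comp (by fun_prop)
  have h0 : L ≤ ENNReal.ofReal (κ * F.toReal) := by
    refine ge_of_tendsto (x := 𝓝[>] F.toReal)
      ((hcont.tendsto F.toReal).mono_left nhdsWithin_le_nhds) ?_
    filter_upwards [self_mem_nhdsWithin] with M hM using key M hM
  rwa [ENNReal.ofReal_mul hκ0.le, ENNReal.ofReal_toReal hFtop] at h0
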